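/- Let $n,m\in\mathbb N$, let $t<N$ be nonnegative integers and let $d\ge 2$ be an integer delay. For $k\le N-1$ put $\mathbb T_k=\{k,\dots,N-1\}$ ($\mathbb T_k=\varnothing$ if $k\ge N$). Let $A_k,C_k\in\mathbb R^{n\times n}$, $B_k,D_k\in\mathbb R^{n\times m}$ and symmetric $Q_k\in\mathbb R^{n\times n}$, $R_k\in\mathbb R^{m\times m}$ ($k\in\mathbb T_t$), $G\in\mathbb R^{n\times n}$ be deterministic; no definiteness is assumed. Let $w_0,\dots,w_{N-1}$ be real random variables on a probability space, $\mathcal F_k=\sigma(w_0,\dots,w_{k-1})$ ($\mathcal F_0$ trivial), $\mathbb E_k=\mathbb E[\,\cdot\,|\mathcal F_k]$, with $\mathbb E_k[w_k]=0$ and $\mathbb E_k[w_k^2]=1$ for $0\le k\le N-1$. For $\ell\in\mathbb T_t$ with $\ell-d<t$, the symbols $\mathcal F_{\ell-d}$, $\mathbb E_{\ell-d}$ are understood as $\mathcal F_t$, $\mathbb E_t$. For $k\in\mathbb T_t$ and $\xi\in\mathbb R^n$, let $\mathcal U_{ad}^k$ be the set of $u=(u_k,\dots,u_{N-1})$ such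 that $u_\ell$ is an $\mathbb R^m$-valued, $\mathcal F_{\ell-d}$-measurable, square-integrable random vector for each $\ell\in\mathbb T_k$. For $u\in\mathcal U_{ad}^k$ let $$X_{\ell+1}=(A_\ell X_\ell+B_\ell u_\ell)+(C_\ell X_\ell+D_\ell u_\ell)w_\ell,\quad \ell\in\mathbb T_k,\qquad X_k=\xi,$$ $$J(k,\xi;u)=\sum_{\ell=k}^{N-1}\mathbb E\big[X_\ell^TQ_\ell X_\ell+u_\ell^TR_\ell u_\ell\big]+\mathbb E\big[X_N^TGX_N\big],\qquad V(k,\xi)=\inf_{u\in\mathcal U_{ad}^k}J(k,\xi;u).$$ Problem (LQ) is *finite* if $V(k,\xi)>-\infty$ for all $(k,\xi)\in\mathbb T_t\times\mathbb R^n$, and *solvable* if for every $(k,\xi)\in\mathbb T_t\times\mathbb R^n$ there is an optimal control, i.e. a $\bar u\in\mathcal U_{ad}^k$ with $J(k,\xi;\bar u)=V(k,\xi)$. For matrices $P^{(i)}_k\in\mathbb R^{n\times n}$ and $k\in\mathbb T_t$, put $q_k=d$ if $k\ge t+d$ and $q_k=k+1-t$ if $k<t+d$, and $$W_k=R_k+\sum_{i=0}^{q_k}B_k^TP^{(i)}_{k+1}B_k+D_k^TP^{(0)}_{k+1}D_k,\qquad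 H_k=\sum_{i=0}^{q_k}B_k^TP^{(i)}_{k+1}A_k+D_k^TP^{(0)}_{k+1}C_k,$$ $$S_k=Q_k+A_k^T\big(P^{(0)}_{k+1}+P^{(1)}_{k+1}\big)A_k+C_k^TP^{(0)}_{k+1}C_k.$$ With $W^\dagger$ the Moore–Penrose inverse, the *Riccati-like equations* are, for $k\in\mathbb T_t$, * $P^{(0)}_N=G$ and $P^{(j)}_N=0$ for $1\le j\le d$; * if $k\ge t+d$: $P^{(0)}_k=S_k$, $P^{(i)}_k=A_k^TP^{(i+1)}_{k+1}A_k$ for $1\le i\le d-1$, and $P^{(d)}_k=-H_k^TW_k^\dagger H_k$; * if $t+1\le k\le t+d-1$: $P^{(0)}_k=S_k$, $P^{(i)}_k=A_k^TP^{(i+1)}_{k+1}A_k$ for $1\le i\le k-t-1$, and $P^{(k-t)}_k=A_k^TP^{(k+1-t)}_{k+1}A_k-H_k^TW_k^\dagger H_k$; * if $k=t$: $P^{(0)}_t=S_t-H_t^TW_t^\dagger H_t$. The *constrained Riccati-like equations* are these equations together with $W_kW_k^\dagger H_k=H_k$ and $W_k\ge0$ (positive semidefinite) for all $k\in\mathbb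 T_t$. The *coupled linear matrix equality-inequalities* (LMEIs) are, for $k\in\mathbb T_t$, * $P^{(0)}_N\le G$ and $P^{(j)}_N=0$ for $1\le j\le d$; * if $k\ge t+d$: $P^{(0)}_k\le S_k$, $P^{(i)}_k=A_k^TP^{(i+1)}_{k+1}A_k$ for $1\le i\le d-1$, and $\begin{bmatrix}-P^{(d)}_k&H_k^T\\H_k&W_k\end{bmatrix}\ge0$; * if $t+1\le k\le t+d-1$: $P^{(0)}_k\le S_k$, $P^{(i)}_k=A_k^TP^{(i+1)}_{k+1}A_k$ for $1\le i\le k-t-1$, and $\begin{bmatrix}A_k^TP^{(k+1-t)}_{k+1}A_k-P^{(k-t)}_k&H_k^T\\H_k&W_k\end{bmatrix}\ge0$; * if $k=t$: $\begin{bmatrix}S_t-P^{(0)}_t&H_t^T\\H_t&W_t\end{bmatrix}\ge0$; and $\mathcal M$ is the set of their solutions $(P^{(0)},\dots,P^{(d)})$. **Theorem.** The Riccati-like equations have a solution, and the following are equivalent: (i) Problem (LQ) is finite; (ii) Problem (LQ) is solvable; (iii) the solution of the Riccati-like equations satisfies $W_kW_k^\dagger H_k=H_k$ and $W_k\ge0$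 for all $k\in\mathbb T_t$; in other words, the constrained Riccati-like equations are solvable; (iv) $\mathcal M\neq\varnothing$. Under any of these conditions, with $P$, $W$, $H$ from the solution of the Riccati-like equations, for every $(k,\xi)\in\mathbb T_t\times\mathbb R^n$ an optimal control is $$u^{*}_\ell=-W_\ell^\dagger H_\ell\,\mathbb E_{\ell-d}X^{*}_\ell,\quad \ell\in\mathbb T_k,$$ where $X^{*}_k=\xi$ and $$X^{*}_{\ell+1}=\big(A_\ell X^{*}_\ell-B_\ell W_\ell^\dagger H_\ell\mathbb E_{\ell-d}X^{*}_\ell\big)+\big(C_\ell X^{*}_\ell-D_\ell W_\ell^\dagger H_\ell\mathbb E_{\ell-d}X^{*}_\ell\big)w_\ell,\quad \ell\in\mathbb T_k,$$ and the optimal value is $$V(k,\xi)=\sum_{i=0}^{k-t}\xi^TP^{(i)}_k\xi\ \text{ if } t\le k\le t+d-1,\qquad V(k,\xi)=\sum_{i=0}^{d}\xi^TP^{(i)}_k\xi\ \text{ if } k\ge t+d.$$ -/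

import Mathlib

open MeasureTheory Matrix

namespace DelayLQ

/-! ### The Moore–Penrose inverse of a real matrix -/

/-- The four Penrose equations: `X` is a Moore–Penrose inverse of the real matrix `M`. -/
structure IsMoorePenrose {p q : ℕ} (M : Matrix (Fin p) (Fin q) ℝ)
    (X : Matrix (Fin q) (Fin p) ℝ) : Prop where
  mul_mul_self : M * X * M = M
  mul_mul_inv : X * M * X = X
  symm_left : (M * X)ᵀ = M * X
  symm_right : (X * M)ᵀ = X * M

theorem exists_isMoorePenrose {p q : ℕ} (M : Matrix (Fin p) (Fin q) ℝ) :
    ∃ X, IsMoorePenrose M X := by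
  have hS : (Mᵀ * M).IsHermitian := by
    simpa [conjTranspose_eq_transpose_of_trivial] using isHermitian_conjTranspose_mul_self M
  obtain ⟨T, hT, hTS, hSTS, hTST⟩ : ∃ T : Matrix (Fin q) (Fin q) ℝ, Tᵀ = T ∧
      (T * (Mᵀ * M))ᵀ = T * (Mᵀ * M) ∧ (Mᵀ * M) * T * (Mᵀ * M) = Mᵀ * M ∧
      T * (Mᵀ * M) * T = T := by
    set S := Mᵀ * M with hSdef
    set U : Matrix (Fin q) (Fin q) ℝ := (hS.eigenvectorUnitary).1 with hU
    have hUU : Uᵀ * U = 1 := by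
      have := Unitary.coe_star_mul_self hS.eigenvectorUnitary
      simpa [star_eq_conjTranspose, conjTranspose_eq_transpose_of_trivial] using this
    set e := hS.eigenvalues
    have hSpec : S = U * diagonal e * Uᵀ := by
      have := hS.spectral_theorem
      rw [Unitary.conjStarAlgAut_apply] at this
      simpa [star_eq_conjTranspose, conjTranspose_eq_transpose_of_trivial, Function.comp_def]
        using this
    have key : ∀ a b : Fin q → ℝ, U * diagonal a * Uᵀ * (U * diagonal b * Uᵀ)
        = U * diagonal (fun i => a i * b i) * Uᵀ := by
      intro a b
      calc U * diagonal a * Uᵀ * (U * diagonal b * Uᵀ)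
          = U * diagonal a * (Uᵀ * U) * diagonal b * Uᵀ := by simp only [Matrix.mul_assoc]
        _ = U * diagonal (fun i => a i * b i) * Uᵀ := by
          rw [hUU, Matrix.mul_one, Matrix.mul_assoc U, diagonal_mul_diagonal]
    have keyT : ∀ a : Fin q → ℝ, (U * diagonal a * Uᵀ)ᵀ = U * diagonal a * Uᵀ := by
      intro a
      simp [transpose_mul, Matrix.mul_assoc]
    refine ⟨U * diagonal (fun i => (e i)⁻¹) * Uᵀ, keyT _, ?_, ?_, ?_⟩
    · rw [hSpec, key, keyT]
    · rw [hSpec, key, key]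
      congr 3
      funext i
      by_cases h : e i = 0 <;> simp [h]
    · rw [hSpec, key, key]
      congr 3
      funext i
      by_cases h : e i = 0 <;> simp [h]
  refine ⟨T * Mᵀ, ?_, ?_, ?_, ?_⟩
  · have h0 : (M * T * (Mᵀ * M) - M)ᵀ * (M * T * (Mᵀ * M) - M) = 0 := by
      have h1 : Mᵀ * (M * T * (Mᵀ * M) - M) = 0 := by
        rw [Matrix.mul_sub, sub_eq_zero]
        calc Mᵀ * (M * T * (Mᵀ * M)) = Mᵀ * M * T * (Mᵀ * M) := by simp only [Matrix.mul_assoc]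
          _ = Mᵀ * M := hSTS
      have h2 : M * T * (Mᵀ * M) - M = M * (T * (Mᵀ * M) - 1) := by
        rw [Matrix.mul_sub, Matrix.mul_one, Matrix.mul_assoc]
      conv_lhs => rw [h2, transpose_mul, ← h2, Matrix.mul_assoc, h1, Matrix.mul_zero]
    have h3 : M * T * (Mᵀ * M) - M = 0 := by
      rw [← conjTranspose_eq_transpose_of_trivial] at h0
      exact conjTranspose_mul_self_eq_zero.mp h0
    calc M * (T * Mᵀ) * M = M * T * (Mᵀ * M) := by simp only [Matrix.mul_assoc]
      _ = M := sub_eq_zero.mp h3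
  · calc T * Mᵀ * M * (T * Mᵀ) = T * (Mᵀ * M) * T * Mᵀ := by simp only [Matrix.mul_assoc]
      _ = T * Mᵀ := by rw [hTST]
  · simp [transpose_mul, hT, Matrix.mul_assoc]
  · rw [Matrix.mul_assoc, hTS]

theorem IsMoorePenrose.unique {p q : ℕ} {M : Matrix (Fin p) (Fin q) ℝ}
    {X Y : Matrix (Fin q) (Fin p) ℝ} (hX : IsMoorePenrose M X) (hY : IsMoorePenrose M Y) :
    X = Y := by
  have h1 : M * X = M * Y := by
    calc M * X = (M * X)ᵀ := hX.symm_left.symm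
      _ = (M * Y * (M * X))ᵀ := by rw [← Matrix.mul_assoc, hY.mul_mul_self]
      _ = M * X * (M * Y) := by rw [transpose_mul, hX.symm_left, hY.symm_left]
      _ = M * Y := by rw [← Matrix.mul_assoc, hX.mul_mul_self]
  have h2 : X * M = Y * M := by
    calc X * M = X * (M * Y * M) := by rw [hY.mul_mul_self]
      _ = X * M * (Y * M) := by simp only [Matrix.mul_assoc]
      _ = (Y * M * (X * M))ᵀ := by rw [transpose_mul, hX.symm_right, hY.symm_right]
      _ = (Y * (M * X * M))ᵀ := by simp only [Matrix.mul_assoc]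
      _ = Y * M := by rw [hX.mul_mul_self, hY.symm_right]
  calc X = X * M * X := hX.mul_mul_inv.symm
    _ = Y * (M * X) := by rw [h2, Matrix.mul_assoc]
    _ = Y * M * Y := by rw [h1, Matrix.mul_assoc]
    _ = Y := hY.mul_mul_inv

/-- The Moore–Penrose inverse `M†`. -/
noncomputable def pinv {p q : ℕ} (M : Matrix (Fin p) (Fin q) ℝ) : Matrix (Fin q) (Fin p) ℝ :=
  (exists_isMoorePenrose M).choose

theorem pinv_spec {p q : ℕ} (M : Matrix (Fin p) (Fin q) ℝ) : IsMoorePenrose M (pinv M) :=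
  (exists_isMoorePenrose M).choose_spec

/-! ### The data of the problem and the noise -/

/-- Deterministic data: horizon `N`, first time `t`, delay `d`, system matrices `A, B, C, D` and
weights `Q, R, G`. Only the matrices at times `t ≤ k < N` are ever used. -/
structure Data (n m : ℕ) where
  N : ℕ
  t : ℕ
  d : ℕ
  A : ℕ → Matrix (Fin n) (Fin n) ℝ
  B : ℕ → Matrix (Fin n) (Fin m) ℝ
  C : ℕ → Matrix (Fin n) (Fin n) ℝ
  D : ℕ → Matrix (Fin n) (Fin m) ℝ
  Q : ℕ → Matrix (Fin n) (Fin n) ℝ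
  R : ℕ → Matrix (Fin m) (Fin m) ℝ
  G : Matrix (Fin n) (Fin n) ℝ

/-- `ℱ_k = σ(w_0, …, w_{k-1})`; in particular `ℱ_0` is trivial. -/
abbrev sigmaNoise {Ω : Type*} (w : ℕ → Ω → ℝ) (k : ℕ) : MeasurableSpace Ω :=
  ⨆ l : ℕ, ⨆ _ : l < k, MeasurableSpace.comap (w l) inferInstance

/-- `w_0, …, w_{N-1}` is a martingale difference sequence with conditional variance one:
`E[w_k | ℱ_k] = 0` and `E[w_k² | ℱ_k] = 1`. -/
structure IsNoise {Ω : Type*} [MeasurableSpace Ω] (μ : Measure Ω) (N : ℕ) (w : ℕ → Ω → ℝ) :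
    Prop where
  measurable : ∀ k < N, Measurable (w k)
  memLp : ∀ k < N, MemLp (w k) 2 μ
  condExp_eq_zero : ∀ k < N, condExp (sigmaNoise w k) μ (w k) =ᵐ[μ] fun _ => 0
  condExp_sq_eq_one : ∀ k < N, condExp (sigmaNoise w k) μ (fun ω => w k ω ^ 2) =ᵐ[μ] fun _ => 1

namespace Data

variable {n m : ℕ}

/-! ### Controls, state, cost -/

/-- The information available to the controller at time `l`: `ℱ_{l-d}`, understood as `ℱ_t` when
`l - d < t`. -/
abbrev info (S : Data n m) {Ω : Type*} (w : ℕ → Ω → ℝ) (l : ℕ) : MeasurableSpace Ω :=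
  sigmaNoise w (max (l - S.d) S.t)

/-- The admissible set `𝒰_ad^k`: square integrable controls `u_k, …, u_{N-1}` (entries at other
times are irrelevant) such that `u_l` is measurable for the delayed information at time `l`. -/
def admissible (S : Data n m) {Ω : Type*} [MeasurableSpace Ω] (μ : Measure Ω) (w : ℕ → Ω → ℝ)
    (k : ℕ) : Set (ℕ → Ω → (Fin m → ℝ)) :=
  {u | ∀ l, k ≤ l → l < S.N → StronglyMeasurable[S.info w l] (u l) ∧ MemLp (u l) 2 μ}

/-- The state started from `X_k = ξ` under the control `u`:
`X_{l+1} = (A_l X_l + B_l u_l) + (C_l X_l + D_l u_l) w_l` for `l ≥ k` (and, by convention, `ξ` at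
times before `k`, which are never used). -/
def state (S : Data n m) {Ω : Type*} (w : ℕ → Ω → ℝ) (k : ℕ) (ξ : Fin n → ℝ)
    (u : ℕ → Ω → (Fin m → ℝ)) : ℕ → Ω → (Fin n → ℝ)
  | 0 => fun _ => ξ
  | l + 1 => if l < k then fun _ => ξ else fun ω =>
      (S.A l *ᵥ S.state w k ξ u l ω + S.B l *ᵥ u l ω)
        + w l ω • (S.C l *ᵥ S.state w k ξ u l ω + S.D l *ᵥ u l ω)

/-- The cost functional `J(k, ξ; u)`. -/
noncomputable def cost (S : Data n m) {Ω : Type*} [MeasurableSpace Ω] (μ : Measure Ω)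
    (w : ℕ → Ω → ℝ) (k : ℕ) (ξ : Fin n → ℝ) (u : ℕ → Ω → (Fin m → ℝ)) : ℝ :=
  (∑ l ∈ Finset.Ico k S.N,
    ∫ ω, (S.state w k ξ u l ω ⬝ᵥ (S.Q l *ᵥ S.state w k ξ u l ω)
      + u l ω ⬝ᵥ (S.R l *ᵥ u l ω)) ∂μ)
  + ∫ ω, S.state w k ξ u S.N ω ⬝ᵥ (S.G *ᵥ S.state w k ξ u S.N ω) ∂μ

/-- The value `V(k, ξ) = inf_{u ∈ 𝒰_ad^k} J(k, ξ; u)`, possibly `-∞`. -/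
noncomputable def value (S : Data n m) {Ω : Type*} [MeasurableSpace Ω] (μ : Measure Ω)
    (w : ℕ → Ω → ℝ) (k : ℕ) (ξ : Fin n → ℝ) : EReal :=
  ⨅ u ∈ S.admissible μ w k, (S.cost μ w k ξ u : EReal)

/-- The problem is finite: the value is `> -∞` at every initial pair `(k, ξ)`, `t ≤ k < N`. -/
def IsFinite (S : Data n m) {Ω : Type*} [MeasurableSpace Ω] (μ : Measure Ω)
    (w : ℕ → Ω → ℝ) : Prop :=
  ∀ k, S.t ≤ k → k < S.N → ∀ ξ : Fin n → ℝ, ⊥ < S.value μ w k ξ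

/-- `u` is an optimal control for the initial pair `(k, ξ)`. -/
def IsOptimal (S : Data n m) {Ω : Type*} [MeasurableSpace Ω] (μ : Measure Ω)
    (w : ℕ → Ω → ℝ) (k : ℕ) (ξ : Fin n → ℝ) (u : ℕ → Ω → (Fin m → ℝ)) : Prop :=
  u ∈ S.admissible μ w k ∧ (S.cost μ w k ξ u : EReal) = S.value μ w k ξ

/-- The problem is solvable: every initial pair `(k, ξ)`, `t ≤ k < N`, has an optimal control. -/
def IsSolvable (S : Data n m) {Ω : Type*} [MeasurableSpace Ω] (μ : Measure Ω)
    (w : ℕ → Ω → ℝ) : Prop :=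
  ∀ k, S.t ≤ k → k < S.N → ∀ ξ : Fin n → ℝ, ∃ u, S.IsOptimal μ w k ξ u

/-! ### Riccati-like equations and linear matrix equality-inequalities

A family `(P^{(0)}, …, P^{(d)})` is encoded as `P : ℕ → ℕ → Matrix`, with `P i k = P^{(i)}_k`. The
entries `P^{(i)}_k` with `i > d`, with `k < t + d` and `i > k - t` (unless `k = N`), or with `k < t`
or `k > N` do not occur in the equations. -/

/-- The largest upper index in the sums over `P_k`: `d` if `k ≥ t + d`, and `k - t` if
`t ≤ k < t + d`. -/
def top (S : Data n m) (k : ℕ) : ℕ := if S.t + S.d ≤ k then S.d else k - S.t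

/-- The largest upper index in the sums defining `W_k` and `H_k`: `d` if `k ≥ t + d`, and
`k + 1 - t` if `t ≤ k < t + d`. -/
def topWH (S : Data n m) (k : ℕ) : ℕ := if S.t + S.d ≤ k then S.d else k + 1 - S.t

/-- `W_k = R_k + ∑_i B_kᵀ P^{(i)}_{k+1} B_k + D_kᵀ P^{(0)}_{k+1} D_k`. -/
def W (S : Data n m) (P : ℕ → ℕ → Matrix (Fin n) (Fin n) ℝ) (k : ℕ) : Matrix (Fin m) (Fin m) ℝ :=
  S.R k + (∑ i ∈ Finset.range (S.topWH k + 1), (S.B k)ᵀ * P i (k + 1) * S.B k)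
    + (S.D k)ᵀ * P 0 (k + 1) * S.D k

/-- `H_k = ∑_i B_kᵀ P^{(i)}_{k+1} A_k + D_kᵀ P^{(0)}_{k+1} C_k`. -/
def H (S : Data n m) (P : ℕ → ℕ → Matrix (Fin n) (Fin n) ℝ) (k : ℕ) : Matrix (Fin m) (Fin n) ℝ :=
  (∑ i ∈ Finset.range (S.topWH k + 1), (S.B k)ᵀ * P i (k + 1) * S.A k)
    + (S.D k)ᵀ * P 0 (k + 1) * S.C k

/-- `Q_k + A_kᵀ (P^{(0)}_{k+1} + P^{(1)}_{k+1}) A_k + C_kᵀ P^{(0)}_{k+1} C_k`. -/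
def rhs (S : Data n m) (P : ℕ → ℕ → Matrix (Fin n) (Fin n) ℝ) (k : ℕ) : Matrix (Fin n) (Fin n) ℝ :=
  S.Q k + (S.A k)ᵀ * (P 0 (k + 1) + P 1 (k + 1)) * S.A k + (S.C k)ᵀ * P 0 (k + 1) * S.C k

/-- `H_kᵀ W_k† H_k`. -/
noncomputable def corr (S : Data n m) (P : ℕ → ℕ → Matrix (Fin n) (Fin n) ℝ) (k : ℕ) :
    Matrix (Fin n) (Fin n) ℝ :=
  (S.H P k)ᵀ * pinv (S.W P k) * S.H P k

/-- The coupled Riccati-like equations, without the constraints on `W_k` and `H_k`. All times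
`k` range over `t ≤ k < N`. -/
structure IsRiccati (S : Data n m) (P : ℕ → ℕ → Matrix (Fin n) (Fin n) ℝ) : Prop where
  terminal_zero : P 0 S.N = S.G
  terminal : ∀ j, 1 ≤ j → j ≤ S.d → P j S.N = 0
  /- `k ≥ t + d` -/
  late_zero : ∀ k, S.t + S.d ≤ k → k < S.N → P 0 k = S.rhs P k
  late_mid : ∀ k, S.t + S.d ≤ k → k < S.N → ∀ i, 1 ≤ i → i ≤ S.d - 1 →
    P i k = (S.A k)ᵀ * P (i + 1) (k + 1) * S.A k
  late_last : ∀ k, S.t + S.d ≤ k → k < S.N → P S.d k = - S.corr P k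
  /- `t + 1 ≤ k ≤ t + d - 1` (for `k = t + 1` the second equation is void) -/
  early_zero : ∀ k, S.t + 1 ≤ k → k < S.t + S.d → k < S.N → P 0 k = S.rhs P k
  early_mid : ∀ k, S.t + 1 ≤ k → k < S.t + S.d → k < S.N → ∀ i, 1 ≤ i → i ≤ k - S.t - 1 →
    P i k = (S.A k)ᵀ * P (i + 1) (k + 1) * S.A k
  early_last : ∀ k, S.t + 1 ≤ k → k < S.t + S.d → k < S.N →
    P (k - S.t) k = (S.A k)ᵀ * P (k + 1 - S.t) (k + 1) * S.A k - S.corr P k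
  /- `k = t` -/
  initial : P 0 S.t = S.rhs P S.t - S.corr P S.t

/-- The constraints `W_k W_k† H_k = H_k` and `W_k ≥ 0` for `t ≤ k < N`. -/
def Constraint (S : Data n m) (P : ℕ → ℕ → Matrix (Fin n) (Fin n) ℝ) : Prop :=
  ∀ k, S.t ≤ k → k < S.N →
    S.W P k * pinv (S.W P k) * S.H P k = S.H P k ∧ (S.W P k).PosSemidef

/-- The coupled linear matrix equality-inequalities (LMEIs). All times `k` range over
`t ≤ k < N`; `X ≤ Y` means that `Y - X` is (symmetric) positive semidefinite. -/
structure IsLMEI (S : Data n m) (P : ℕ → ℕ → Matrix (Fin n) (Fin n) ℝ) : Prop where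
  terminal_zero : (S.G - P 0 S.N).PosSemidef
  terminal : ∀ j, 1 ≤ j → j ≤ S.d → P j S.N = 0
  /- `k ≥ t + d` -/
  late_zero : ∀ k, S.t + S.d ≤ k → k < S.N → (S.rhs P k - P 0 k).PosSemidef
  late_mid : ∀ k, S.t + S.d ≤ k → k < S.N → ∀ i, 1 ≤ i → i ≤ S.d - 1 →
    P i k = (S.A k)ᵀ * P (i + 1) (k + 1) * S.A k
  late_last : ∀ k, S.t + S.d ≤ k → k < S.N →
    (fromBlocks (- P S.d k) (S.H P k)ᵀ (S.H P k) (S.W P k)).PosSemidef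
  /- `t + 1 ≤ k ≤ t + d - 1` (for `k = t + 1` the second equation is void) -/
  early_zero : ∀ k, S.t + 1 ≤ k → k < S.t + S.d → k < S.N → (S.rhs P k - P 0 k).PosSemidef
  early_mid : ∀ k, S.t + 1 ≤ k → k < S.t + S.d → k < S.N → ∀ i, 1 ≤ i → i ≤ k - S.t - 1 →
    P i k = (S.A k)ᵀ * P (i + 1) (k + 1) * S.A k
  early_last : ∀ k, S.t + 1 ≤ k → k < S.t + S.d → k < S.N →
    (fromBlocks ((S.A k)ᵀ * P (k + 1 - S.t) (k + 1) * S.A k - P (k - S.t) k)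
      (S.H P k)ᵀ (S.H P k) (S.W P k)).PosSemidef
  /- `k = t` -/
  initial : (fromBlocks (S.rhs P S.t - P 0 S.t)
      (S.H P S.t)ᵀ (S.H P S.t) (S.W P S.t)).PosSemidef

/-- The set `ℳ` of solutions of the LMEIs. -/
def lmeiSolutions (S : Data n m) : Set (ℕ → ℕ → Matrix (Fin n) (Fin n) ℝ) :=
  {P | S.IsLMEI P}

/-! ### The closed loop -/

/-- The feedback `-W_l† H_l E_{l-d} X_l` at time `l`, evaluated on a random vector `X`. -/
noncomputable def feedback (S : Data n m) {Ω : Type*} [MeasurableSpace Ω] (μ : Measure Ω)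
    (w : ℕ → Ω → ℝ) (P : ℕ → ℕ → Matrix (Fin n) (Fin n) ℝ) (l : ℕ) (X : Ω → (Fin n → ℝ)) :
    Ω → (Fin m → ℝ) :=
  fun ω => - ((pinv (S.W P l) * S.H P l) *ᵥ condExp (S.info w l) μ X ω)

/-- The closed-loop state started from `X_k = ξ`: the state equation with
`u_l = -W_l† H_l E_{l-d} X_l`. -/
noncomputable def closedState (S : Data n m) {Ω : Type*} [MeasurableSpace Ω] (μ : Measure Ω)
    (w : ℕ → Ω → ℝ) (P : ℕ → ℕ → Matrix (Fin n) (Fin n) ℝ) (k : ℕ) (ξ : Fin n → ℝ) :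
    ℕ → Ω → (Fin n → ℝ)
  | 0 => fun _ => ξ
  | l + 1 => if l < k then fun _ => ξ else fun ω =>
      (S.A l *ᵥ S.closedState μ w P k ξ l ω
          + S.B l *ᵥ S.feedback μ w P l (S.closedState μ w P k ξ l) ω)
        + w l ω • (S.C l *ᵥ S.closedState μ w P k ξ l ω
          + S.D l *ᵥ S.feedback μ w P l (S.closedState μ w P k ξ l) ω)

/-- The control `u_l = -W_l† H_l E_{l-d} X_l` along the closed-loop state `X`. -/
noncomputable def closedControl (S : Data n m) {Ω : Type*} [MeasurableSpace Ω] (μ : Measure Ω)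
    (w : ℕ → Ω → ℝ) (P : ℕ → ℕ → Matrix (Fin n) (Fin n) ℝ) (k : ℕ) (ξ : Fin n → ℝ) :
    ℕ → Ω → (Fin m → ℝ) :=
  fun l => S.feedback μ w P l (S.closedState μ w P k ξ l)

/-- The closed-loop state is the state under the closed-loop control. -/
theorem closedState_eq_state (S : Data n m) {Ω : Type*} [MeasurableSpace Ω] (μ : Measure Ω)
    (w : ℕ → Ω → ℝ) (P : ℕ → ℕ → Matrix (Fin n) (Fin n) ℝ) (k : ℕ) (ξ : Fin n → ℝ) (l : ℕ) :
    S.closedState μ w P k ξ l = S.state w k ξ (S.closedControl μ w P k ξ) l := by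
  induction l with
  | zero => rfl
  | succ l ih => simp only [closedState, state, ← ih, closedControl]

end Data

end DelayLQ

/-! The cost-to-go is a quadratic form in all the delayed estimates Y_i = E[X_l | ℱ_{max(l-i,t)}],
namely ∑ E[Y_iᵀ P^{(i)}_l Y_i] (`energy`). One step of the dynamics preserves this class. The
estimate of index i+1 at time l+1 is A Y_i + B u: conditioning kills the noise term and leaves u,
which is measurable for the coarsest of these σ-algebras. Index 0 also produces the diffusion term
in C and D, with weight one because the conditional variance is one. Collecting terms
(`stage_add_energy_next`) leaves the forms `pre` plus E[uᵀWu + 2uᵀHy], where y = E_{l-d}X is the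
last estimate.

If W W† H = H, completing the square in u puts -HᵀW†H on the last estimate. This is the Riccati-like
recursion, and what remains is the `excess` E[(u + W†Hy)ᵀ W (u + W†Hy)]. Summed over time
(`IsRiccati.tail_cost`), the cost is ∑ ξᵀP^{(i)}_k ξ plus the total excess. When moreover W ≥ 0, the
excess is nonnegative and vanishes for the feedback, which is therefore optimal.

Conversely, finiteness forces the constraints by backward induction (`IsFinite.constraint`). Playing
a constant v at time k and the feedback afterwards costs vᵀW_k v + 2vᵀH_k ξ plus a constant, and a
quadratic function bounded below has W_k ≥ 0 and H_k ξ in the range of W_k.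

For the LMEIs the same step identity becomes an inequality, whose telescoped form bounds the cost
below independently of the control. A constrained Riccati solution is itself an LMEI solution. -/

namespace DelayLQ

/-! ### Calculus of the bilinear expectations E[Xᵀ P Y] -/

section QuadraticExpectation

variable {Ω : Type*} {mΩ : MeasurableSpace Ω} {μ : Measure Ω} {p q r : ℕ}

/-- The expectation `E[Xᵀ P Y]`. -/
noncomputable def qexp (μ : Measure Ω) (P : Matrix (Fin p) (Fin q) ℝ) (X : Ω → Fin p → ℝ)
    (Y : Ω → Fin q → ℝ) : ℝ :=
  ∫ ω, X ω ⬝ᵥ (P *ᵥ Y ω) ∂μ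

/-- The bilinear form of a matrix as a continuous bilinear map. -/
noncomputable def bilin (P : Matrix (Fin p) (Fin q) ℝ) :
    (Fin p → ℝ) →L[ℝ] (Fin q → ℝ) →L[ℝ] ℝ :=
  LinearMap.toContinuousBilinearMap (Matrix.toLinearMap₂' ℝ P)

theorem bilin_apply (P : Matrix (Fin p) (Fin q) ℝ) (x : Fin p → ℝ) (y : Fin q → ℝ) :
    bilin P x y = x ⬝ᵥ (P *ᵥ y) := by
  simp [bilin, Matrix.toLinearMap₂'_apply']

theorem integrable_dotProduct_mulVec {P : Matrix (Fin p) (Fin q) ℝ} {X : Ω → Fin p → ℝ}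
    {Y : Ω → Fin q → ℝ} (hX : MemLp X 2 μ) (hY : MemLp Y 2 μ) :
    Integrable (fun ω => X ω ⬝ᵥ (P *ᵥ Y ω)) μ := by
  simp_rw [← bilin_apply]
  exact memLp_one_iff_integrable.1 ((bilin P).memLp_of_bilin 1 hX hY)

theorem MemLp.mulVec {X : Ω → Fin q → ℝ} (hX : MemLp X 2 μ) (A : Matrix (Fin p) (Fin q) ℝ) :
    MemLp (fun ω => A *ᵥ X ω) 2 μ :=
  ContinuousLinearMap.comp_memLp' (LinearMap.toContinuousLinearMap (Matrix.toLin' A)) hX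

theorem StronglyMeasurable.mulVec {F : MeasurableSpace Ω} {X : Ω → Fin q → ℝ}
    (hX : StronglyMeasurable[F] X) (A : Matrix (Fin p) (Fin q) ℝ) :
    StronglyMeasurable[F] (fun ω => A *ᵥ X ω) :=
  (LinearMap.toContinuousLinearMap (Matrix.toLin' A)).continuous.comp_stronglyMeasurable hX

theorem StronglyMeasurable.dotProduct_mulVec {F : MeasurableSpace Ω}
    {P : Matrix (Fin p) (Fin q) ℝ} {X : Ω → Fin p → ℝ} {Y : Ω → Fin q → ℝ}
    (hX : StronglyMeasurable[F] X) (hY : StronglyMeasurable[F] Y) :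
    StronglyMeasurable[F] (fun ω => X ω ⬝ᵥ (P *ᵥ Y ω)) := by
  have h : Continuous fun z : (Fin p → ℝ) × (Fin q → ℝ) => z.1 ⬝ᵥ (P *ᵥ z.2) :=
    continuous_fst.dotProduct (continuous_const.matrix_mulVec continuous_snd)
  exact h.comp_stronglyMeasurable (hX.prodMk hY)

theorem condExp_mulVec {F : MeasurableSpace Ω} {X : Ω → Fin q → ℝ} (hX : Integrable X μ)
    (A : Matrix (Fin p) (Fin q) ℝ) :
    μ[fun ω => A *ᵥ X ω | F] =ᵐ[μ] fun ω => A *ᵥ (μ[X | F]) ω :=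
  ((LinearMap.toContinuousLinearMap (Matrix.toLin' A)).comp_condExp_comm hX).symm

theorem qexp_add_left {P : Matrix (Fin p) (Fin q) ℝ} {X X' : Ω → Fin p → ℝ}
    {Y : Ω → Fin q → ℝ} (hX : MemLp X 2 μ) (hX' : MemLp X' 2 μ) (hY : MemLp Y 2 μ) :
    qexp μ P (fun ω => X ω + X' ω) Y = qexp μ P X Y + qexp μ P X' Y := by
  simp only [qexp, add_dotProduct]
  exact integral_add (integrable_dotProduct_mulVec hX hY) (integrable_dotProduct_mulVec hX' hY)

theorem qexp_transpose (P : Matrix (Fin p) (Fin q) ℝ) (X : Ω → Fin p → ℝ)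
    (Y : Ω → Fin q → ℝ) : qexp μ Pᵀ Y X = qexp μ P X Y := by
  simp only [qexp, mulVec_transpose]
  congr 1; ext ω
  rw [dotProduct_comm, dotProduct_mulVec]

theorem qexp_add_right {P : Matrix (Fin p) (Fin q) ℝ} {X : Ω → Fin p → ℝ}
    {Y Y' : Ω → Fin q → ℝ} (hX : MemLp X 2 μ) (hY : MemLp Y 2 μ) (hY' : MemLp Y' 2 μ) :
    qexp μ P X (fun ω => Y ω + Y' ω) = qexp μ P X Y + qexp μ P X Y' := by
  simp only [← qexp_transpose P]
  exact qexp_add_left hY hY' hX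

theorem qexp_mulVec_right (P : Matrix (Fin p) (Fin q) ℝ) (A : Matrix (Fin q) (Fin r) ℝ)
    (X : Ω → Fin p → ℝ) (Y : Ω → Fin r → ℝ) :
    qexp μ P X (fun ω => A *ᵥ Y ω) = qexp μ (P * A) X Y := by
  simp only [qexp, mulVec_mulVec]

theorem qexp_mulVec_left (P : Matrix (Fin p) (Fin q) ℝ) (A : Matrix (Fin p) (Fin r) ℝ)
    (X : Ω → Fin r → ℝ) (Y : Ω → Fin q → ℝ) :
    qexp μ P (fun ω => A *ᵥ X ω) Y = qexp μ (Aᵀ * P) X Y := by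
  rw [← qexp_transpose, qexp_mulVec_right, ← qexp_transpose, transpose_mul, transpose_transpose]

theorem qexp_add {P P' : Matrix (Fin p) (Fin q) ℝ} {X : Ω → Fin p → ℝ}
    {Y : Ω → Fin q → ℝ} (hX : MemLp X 2 μ) (hY : MemLp Y 2 μ) :
    qexp μ (P + P') X Y = qexp μ P X Y + qexp μ P' X Y := by
  simp only [qexp, add_mulVec, dotProduct_add]
  exact integral_add (integrable_dotProduct_mulVec hX hY) (integrable_dotProduct_mulVec hX hY)

theorem qexp_zero (X : Ω → Fin p → ℝ) (Y : Ω → Fin q → ℝ) : qexp μ 0 X Y = 0 := by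
  simp [qexp]

theorem qexp_sub {P P' : Matrix (Fin p) (Fin q) ℝ} {X : Ω → Fin p → ℝ}
    {Y : Ω → Fin q → ℝ} (hX : MemLp X 2 μ) (hY : MemLp Y 2 μ) :
    qexp μ (P - P') X Y = qexp μ P X Y - qexp μ P' X Y := by
  rw [eq_sub_iff_add_eq, ← qexp_add hX hY, sub_add_cancel]

theorem qexp_sum {ι : Type*} (s : Finset ι) (P : ι → Matrix (Fin p) (Fin q) ℝ)
    {X : Ω → Fin p → ℝ} {Y : Ω → Fin q → ℝ} (hX : MemLp X 2 μ) (hY : MemLp Y 2 μ) :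
    qexp μ (∑ i ∈ s, P i) X Y = ∑ i ∈ s, qexp μ (P i) X Y := by
  classical
  induction s using Finset.induction_on with
  | empty => simp [qexp_zero]
  | insert a s ha ih => rw [Finset.sum_insert ha, Finset.sum_insert ha, qexp_add hX hY, ih]

theorem qexp_congr {P : Matrix (Fin p) (Fin q) ℝ} {X X' : Ω → Fin p → ℝ}
    {Y Y' : Ω → Fin q → ℝ} (hX : X =ᵐ[μ] X') (hY : Y =ᵐ[μ] Y') :
    qexp μ P X Y = qexp μ P X' Y' := by
  apply integral_congr_ae
  filter_upwards [hX, hY] with ω h1 h2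
  rw [h1, h2]

theorem qexp_nonneg {P : Matrix (Fin p) (Fin p) ℝ} (hP : P.PosSemidef) (X : Ω → Fin p → ℝ) :
    0 ≤ qexp μ P X X :=
  integral_nonneg fun ω => by simpa using hP.dotProduct_mulVec_nonneg (X ω)

/-- Since X is F-measurable, Xᵀ P can be pulled into the conditional expectation, and integrating
removes the conditioning. -/
theorem qexp_condExp_right [IsFiniteMeasure μ] {F : MeasurableSpace Ω} (hF : F ≤ mΩ)
    {P : Matrix (Fin p) (Fin q) ℝ}
    {X : Ω → Fin p → ℝ} {Y : Ω → Fin q → ℝ} (hXm : StronglyMeasurable[F] X)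
    (hX : MemLp X 2 μ) (hY : MemLp Y 2 μ) :
    qexp μ P X (μ[Y | F]) = qexp μ P X Y := by
  have h := condExp_bilin_of_stronglyMeasurable_left (μ := μ) (bilin P) hXm
    (g := Y) (by simpa only [bilin_apply] using integrable_dotProduct_mulVec hX hY)
    (hY.integrable one_le_two)
  simp only [bilin_apply] at h
  rw [qexp, ← integral_congr_ae h, integral_condExp hF, qexp]

/-- Expansion of a symmetric form at `A X + B u`. -/
theorem qexp_affine {s : ℕ} {P : Matrix (Fin p) (Fin p) ℝ} (hP : P.IsSymm)
    (A : Matrix (Fin p) (Fin r) ℝ) (B : Matrix (Fin p) (Fin s) ℝ) {X : Ω → Fin r → ℝ}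
    {u : Ω → Fin s → ℝ} (hX : MemLp X 2 μ) (hu : MemLp u 2 μ) :
    qexp μ P (fun ω => A *ᵥ X ω + B *ᵥ u ω) (fun ω => A *ᵥ X ω + B *ᵥ u ω)
      = qexp μ (Aᵀ * P * A) X X + 2 * qexp μ (Bᵀ * P * A) u X + qexp μ (Bᵀ * P * B) u u := by
  have hA := MemLp.mulVec hX A
  have hB := MemLp.mulVec hu B
  have hAB : MemLp (fun ω => A *ᵥ X ω + B *ᵥ u ω) 2 μ := hA.add hB
  rw [qexp_add_left hA hB hAB, qexp_add_right hA hA hB, qexp_add_right hB hA hB]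
  simp only [qexp_mulVec_left, qexp_mulVec_right]
  have : qexp μ (Aᵀ * P * B) X u = qexp μ (Bᵀ * P * A) u X := by
    rw [← qexp_transpose]
    simp [transpose_mul, hP.eq, Matrix.mul_assoc]
  simp only [← Matrix.mul_assoc]
  rw [this]; ring

end QuadraticExpectation

/-! ### Multiplication by a noise of conditional mean zero and conditional variance one -/

section UnitVarianceNoise

variable {Ω : Type*} {mΩ : MeasurableSpace Ω} {μ : Measure Ω} [IsFiniteMeasure μ]
  {F : MeasurableSpace Ω} {v : Ω → ℝ} {p q : ℕ}

/-- The measures v²μ and μ agree on F because E[v² | F] = 1. Working with nonnegative integrals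
avoids any integrability assumption on f, so the integrability of v²f can be deduced from this
identity. -/
theorem lintegral_sq_mul_of_condExp_sq (hF : F ≤ mΩ) (hv : MemLp v 2 μ)
    (hv1 : μ[fun ω => v ω ^ 2 | F] =ᵐ[μ] fun _ => 1) {f : Ω → ENNReal} (hf : Measurable[F] f) :
    ∫⁻ ω, ENNReal.ofReal (v ω ^ 2) * f ω ∂μ = ∫⁻ ω, f ω ∂μ := by
  have hm : AEMeasurable (fun ω => ENNReal.ofReal (v ω ^ 2)) μ :=
    (hv.aestronglyMeasurable.aemeasurable.pow_const 2).ennreal_ofReal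
  have key : (μ.withDensity fun ω => ENNReal.ofReal (v ω ^ 2)).trim hF = μ.trim hF := by
    refine @Measure.ext _ F _ _ fun s hs => ?_
    rw [trim_measurableSet_eq hF hs, trim_measurableSet_eq hF hs, withDensity_apply _ (hF s hs),
      ← ofReal_integral_eq_lintegral_ofReal hv.integrable_sq.integrableOn
        (ae_of_all _ fun ω => sq_nonneg _), ← setIntegral_condExp hF hv.integrable_sq hs,
      setIntegral_congr_ae (hF s hs) (hv1.mono fun ω h _ => h)]
    simp
  calc ∫⁻ ω, ENNReal.ofReal (v ω ^ 2) * f ω ∂μ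
      = ∫⁻ ω, f ω ∂(μ.withDensity fun ω => ENNReal.ofReal (v ω ^ 2)) :=
        (lintegral_withDensity_eq_lintegral_mul₀ hm (hf.mono hF le_rfl).aemeasurable).symm
    _ = ∫⁻ ω, f ω ∂μ := by rw [← lintegral_trim hF hf, key, lintegral_trim hF hf]

theorem integrable_sq_mul_of_condExp_sq (hF : F ≤ mΩ) (hv : MemLp v 2 μ)
    (hv1 : μ[fun ω => v ω ^ 2 | F] =ᵐ[μ] fun _ => 1) {f : Ω → ℝ} (hf : StronglyMeasurable[F] f)
    (hfi : Integrable f μ) : Integrable (fun ω => v ω ^ 2 * f ω) μ := by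
  refine ⟨(hv.aestronglyMeasurable.pow 2).mul hfi.aestronglyMeasurable, ?_⟩
  have h := hfi.hasFiniteIntegral
  rw [hasFiniteIntegral_iff_enorm] at h ⊢
  rw [← lintegral_sq_mul_of_condExp_sq hF hv hv1 hf.enorm] at h
  refine lt_of_eq_of_lt (lintegral_congr fun ω => ?_) h
  rw [enorm_mul, Real.enorm_of_nonneg (sq_nonneg _)]

theorem integral_sq_mul_of_condExp_sq (hF : F ≤ mΩ) (hv : MemLp v 2 μ)
    (hv1 : μ[fun ω => v ω ^ 2 | F] =ᵐ[μ] fun _ => 1) {f : Ω → ℝ} (hf : StronglyMeasurable[F] f)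
    (hfi : Integrable f μ) : ∫ ω, v ω ^ 2 * f ω ∂μ = ∫ ω, f ω ∂μ := by
  rw [← integral_condExp hF]
  refine integral_congr_ae ((condExp_mul_of_stronglyMeasurable_right hf
    (integrable_sq_mul_of_condExp_sq hF hv hv1 hf hfi) hv.integrable_sq).trans ?_)
  filter_upwards [hv1] with ω h
  simp [h]

/-- A product of two square integrable factors is in general only integrable, and independence is
not assumed. Here E[v²|Z|²] = E[|Z|²], by F-measurability of Z. -/
theorem memLp_smul_of_condExp_sq (hF : F ≤ mΩ) (hv : MemLp v 2 μ)
    (hv1 : μ[fun ω => v ω ^ 2 | F] =ᵐ[μ] fun _ => 1) {Z : Ω → Fin p → ℝ}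
    (hZm : StronglyMeasurable[F] Z) (hZ : MemLp Z 2 μ) : MemLp (fun ω => v ω • Z ω) 2 μ := by
  have hm : AEStronglyMeasurable[mΩ] (fun ω => v ω • Z ω) μ :=
    hv.aestronglyMeasurable.smul hZ.aestronglyMeasurable
  rw [memLp_two_iff_integrable_sq_norm hm]
  have := integrable_sq_mul_of_condExp_sq hF hv hv1 (hZm.norm.pow 2)
    ((memLp_two_iff_integrable_sq_norm hZ.aestronglyMeasurable).1 hZ)
  refine this.congr (ae_of_all _ fun ω => ?_)
  simp [norm_smul, mul_pow]

theorem qexp_smul_smul (hF : F ≤ mΩ) (hv : MemLp v 2 μ)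
    (hv1 : μ[fun ω => v ω ^ 2 | F] =ᵐ[μ] fun _ => 1) {P : Matrix (Fin p) (Fin q) ℝ}
    {Z : Ω → Fin p → ℝ} {Z' : Ω → Fin q → ℝ}
    (hZm : StronglyMeasurable[F] Z) (hZ : MemLp Z 2 μ) (hZm' : StronglyMeasurable[F] Z')
    (hZ' : MemLp Z' 2 μ) :
    qexp μ P (fun ω => v ω • Z ω) (fun ω => v ω • Z' ω) = qexp μ P Z Z' := by
  rw [qexp, qexp, ← integral_sq_mul_of_condExp_sq hF hv hv1
    (StronglyMeasurable.dotProduct_mulVec hZm hZm') (integrable_dotProduct_mulVec hZ hZ')]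
  congr 1; ext ω
  simp only [mulVec_smul, smul_dotProduct, dotProduct_smul, smul_eq_mul]
  ring

/-- Z is pulled out over F, where v has conditional mean zero; the tower property then passes to the
coarser F'. -/
theorem condExp_smul_eq_zero (hv : MemLp v 2 μ) {F' : MeasurableSpace Ω} (hF : F ≤ mΩ)
    (hF' : F' ≤ F)
    (hv0 : μ[v | F] =ᵐ[μ] fun _ => 0) {Z : Ω → Fin p → ℝ}
    (hZm : StronglyMeasurable[F] Z) (hi : Integrable (fun ω => v ω • Z ω) μ) :
    μ[fun ω => v ω • Z ω | F'] =ᵐ[μ] fun _ => 0 := by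
  have h : μ[fun ω => v ω • Z ω | F] =ᵐ[μ] (0 : Ω → Fin p → ℝ) := by
    refine (condExp_bilin_of_stronglyMeasurable_right (ContinuousLinearMap.lsmul ℝ ℝ) hZm
      (f := v) hi (hv.integrable one_le_two)).trans ?_
    filter_upwards [hv0] with ω h
    simp [h]
  refine (condExp_condExp_of_le hF' hF).symm.trans ((condExp_congr_ae h).trans ?_)
  rw [condExp_zero]; rfl

theorem qexp_smul_right_eq_zero (hF : F ≤ mΩ) (hv : MemLp v 2 μ)
    (hv0 : μ[v | F] =ᵐ[μ] fun _ => 0)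
    (hv1 : μ[fun ω => v ω ^ 2 | F] =ᵐ[μ] fun _ => 1) {P : Matrix (Fin p) (Fin q) ℝ}
    {Z : Ω → Fin p → ℝ} {Z' : Ω → Fin q → ℝ}
    (hZm : StronglyMeasurable[F] Z) (hZ : MemLp Z 2 μ) (hZm' : StronglyMeasurable[F] Z')
    (hZ' : MemLp Z' 2 μ) : qexp μ P Z (fun ω => v ω • Z' ω) = 0 := by
  have hm := memLp_smul_of_condExp_sq hF hv hv1 hZm' hZ'
  rw [← qexp_condExp_right hF hZm hZ hm, qexp_congr (Filter.EventuallyEq.refl _ Z)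
    (condExp_smul_eq_zero hv hF le_rfl hv0 hZm' (hm.integrable one_le_two))]
  simp [qexp]

/-- The cross terms are linear in v and vanish; the term quadratic in v loses its factor v². -/
theorem qexp_add_smul (hF : F ≤ mΩ) (hv : MemLp v 2 μ)
    (hv0 : μ[v | F] =ᵐ[μ] fun _ => 0)
    (hv1 : μ[fun ω => v ω ^ 2 | F] =ᵐ[μ] fun _ => 1) {P : Matrix (Fin p) (Fin p) ℝ}
    {Z Z' : Ω → Fin p → ℝ}
    (hZm : StronglyMeasurable[F] Z) (hZ : MemLp Z 2 μ) (hZm' : StronglyMeasurable[F] Z')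
    (hZ' : MemLp Z' 2 μ) :
    qexp μ P (fun ω => Z ω + v ω • Z' ω) (fun ω => Z ω + v ω • Z' ω)
      = qexp μ P Z Z + qexp μ P Z' Z' := by
  have hm := memLp_smul_of_condExp_sq hF hv hv1 hZm' hZ'
  have hs : MemLp (fun ω => Z ω + v ω • Z' ω) 2 μ := hZ.add hm
  rw [qexp_add_left hZ hm hs, qexp_add_right hZ hZ hm, qexp_add_right hm hZ hm,
    qexp_smul_smul hF hv hv1 hZm' hZ' hZm' hZ',
    qexp_smul_right_eq_zero hF hv hv0 hv1 hZm hZ hZm' hZ',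
    ← qexp_transpose P (fun ω => v ω • Z' ω), qexp_smul_right_eq_zero hF hv hv0 hv1 hZm hZ hZm' hZ']
  ring

end UnitVarianceNoise

end DelayLQ

/-! ### Symmetric matrices, pseudo-inverses and quadratic functions bounded below -/

namespace DelayLQ

section MoorePenrose

variable {p q : ℕ}

theorem pinv_isSymm {M : Matrix (Fin p) (Fin p) ℝ} (hM : M.IsSymm) : (pinv M).IsSymm := by
  obtain ⟨h1, h2, h3, h4⟩ := pinv_spec M
  refine IsMoorePenrose.unique (M := M) ⟨?_, ?_, ?_, ?_⟩ (pinv_spec M)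
  · simpa [hM.eq, Matrix.mul_assoc] using congrArg transpose h1
  · simpa [hM.eq, Matrix.mul_assoc] using congrArg transpose h2
  · simpa [hM.eq] using h4.symm
  · simpa [hM.eq] using h3.symm

theorem isSymm_transpose_mul_mul {P : Matrix (Fin p) (Fin p) ℝ} (hP : P.IsSymm)
    (A : Matrix (Fin p) (Fin q) ℝ) : (Aᵀ * P * A).IsSymm := by
  simp [Matrix.IsSymm, hP.eq, Matrix.mul_assoc]

/-- With `K = W† H` and `W W† H = H`: `Kᵀ W K = Hᵀ W† H`. -/
theorem transpose_mul_mul_pinv_mul {W : Matrix (Fin p) (Fin p) ℝ} {H : Matrix (Fin p) (Fin q) ℝ}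
    (hW : W.IsSymm) (hH : W * pinv W * H = H) :
    (pinv W * H)ᵀ * W * (pinv W * H) = Hᵀ * pinv W * H := by
  have : W * (pinv W * H) = H := by rw [← Matrix.mul_assoc, hH]
  rw [Matrix.mul_assoc, this, transpose_mul, (pinv_isSymm hW).eq]

/-- With K = W†H the block matrix is [K 1]ᵀ W [K 1]. -/
theorem posSemidef_fromBlocks_pinv {W : Matrix (Fin p) (Fin p) ℝ} {H : Matrix (Fin p) (Fin q) ℝ}
    (hW : W.PosSemidef) (hH : W * pinv W * H = H) :
    (fromBlocks (Hᵀ * pinv W * H) Hᵀ H W).PosSemidef := by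
  have hS : W.IsSymm := by simpa using hW.isHermitian
  have h1 : W * (pinv W * H) = H := by rw [← Matrix.mul_assoc, hH]
  have h2 : (pinv W * H)ᵀ * W = Hᵀ := by
    simpa [hS.eq, (pinv_isSymm hS).eq, Matrix.mul_assoc] using congrArg transpose h1
  have key := hW.conjTranspose_mul_mul_same (fromCols (pinv W * H) (1 : Matrix (Fin p) (Fin p) ℝ))
  rw [conjTranspose_eq_transpose_of_trivial, transpose_fromCols, fromRows_mul,
    fromRows_mul_fromCols, transpose_mul_mul_pinv_mul hS hH, h2] at key
  simpa [h1] using key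

theorem dotProduct_fromBlocks {M : Matrix (Fin q) (Fin q) ℝ} {W : Matrix (Fin p) (Fin p) ℝ}
    {H : Matrix (Fin p) (Fin q) ℝ} (h : (fromBlocks M Hᵀ H W).PosSemidef) (y : Fin q → ℝ)
    (u : Fin p → ℝ) : 0 ≤ y ⬝ᵥ (M *ᵥ y) + 2 * (u ⬝ᵥ (H *ᵥ y)) + u ⬝ᵥ (W *ᵥ u) := by
  have h1 := h.dotProduct_mulVec_nonneg (Sum.elim y u)
  have h2 : y ⬝ᵥ (Hᵀ *ᵥ u) = u ⬝ᵥ (H *ᵥ y) := by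
    rw [mulVec_transpose, dotProduct_comm, dotProduct_mulVec]
  simp [fromBlocks_mulVec, dotProduct_add, h2] at h1
  linarith

/-- A quadratic function `v ↦ vᵀ W v + 2 vᵀ h` is bounded below only if `W ≥ 0` and `h` is in
the range of `W`. -/
theorem posSemidef_of_bddBelow {W : Matrix (Fin p) (Fin p) ℝ} (hW : W.IsSymm)
    {c : ℝ} {h : Fin p → ℝ} (hc : ∀ v : Fin p → ℝ, c ≤ v ⬝ᵥ (W *ᵥ v) + 2 * (v ⬝ᵥ h)) :
    W.PosSemidef := by
  refine PosSemidef.of_dotProduct_mulVec_nonneg (by simpa using hW) fun v => ?_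
  rw [star_trivial]
  by_contra! hneg
  -- Averaging the bounds at s v and -s v cancels the linear term.
  have h1 : ∀ s : ℝ, c ≤ s ^ 2 * (v ⬝ᵥ (W *ᵥ v)) := by
    intro s
    have h1 := hc (s • v)
    have h2 := hc (-s • v)
    simp only [mulVec_smul, smul_dotProduct, dotProduct_smul, smul_eq_mul] at h1 h2
    linarith
  -- This scale makes the quadratic term equal to -(|c| + 1), which is below c.
  have h2 := h1 (√((|c| + 1) / -(v ⬝ᵥ (W *ᵥ v))))
  rw [Real.sq_sqrt (div_nonneg (by positivity) (by linarith))] at h2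
  have h3 : (|c| + 1) / -(v ⬝ᵥ (W *ᵥ v)) * (v ⬝ᵥ (W *ᵥ v)) = -(|c| + 1) := by
    field_simp [hneg.ne]
  linarith [neg_abs_le c]

/-- The residual z = h - W W† h is orthogonal to the range of W, as W W† is symmetric. Along z the
function is therefore linear with slope 2|z|², so a lower bound forces z = 0. -/
theorem mul_pinv_mulVec_of_bddBelow {W : Matrix (Fin p) (Fin p) ℝ}
    {c : ℝ} {h : Fin p → ℝ} (hc : ∀ v : Fin p → ℝ, c ≤ v ⬝ᵥ (W *ᵥ v) + 2 * (v ⬝ᵥ h)) :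
    (W * pinv W) *ᵥ h = h := by
  set z := h - (W * pinv W) *ᵥ h with hz
  obtain ⟨h1, h2, h3, h4⟩ := pinv_spec W
  have hzW : ∀ x, z ⬝ᵥ (W *ᵥ x) = 0 := by
    intro x
    rw [hz, sub_dotProduct, sub_eq_zero, ← h3, mulVec_transpose, ← dotProduct_mulVec,
      mulVec_mulVec, h1]
  have hzh : z ⬝ᵥ h = z ⬝ᵥ z := by
    have : z ⬝ᵥ ((W * pinv W) *ᵥ h) = 0 := by rw [← mulVec_mulVec, hzW]
    nth_rewrite 3 [hz]
    rw [dotProduct_sub, this, sub_zero]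
  have h5 : z ⬝ᵥ z = 0 := by
    by_contra hne
    -- At this multiple of z the function takes the value c - 1.
    have := hc (((c - 1) / (2 * (z ⬝ᵥ z))) • z)
    simp only [mulVec_smul, smul_dotProduct, dotProduct_smul, smul_eq_mul, hzW, hzh] at this
    have h6 : (c - 1) / (2 * (z ⬝ᵥ z)) * (z ⬝ᵥ z) = (c - 1) / 2 := by
      field_simp
    rw [h6] at this
    linarith
  exact (sub_eq_zero.1 (dotProduct_self_eq_zero.1 h5)).symm

end MoorePenrose

/-! ### The filtration generated by the noise -/

section Noise

variable {Ω : Type*}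

theorem sigmaNoise_mono (w : ℕ → Ω → ℝ) {k l : ℕ} (h : k ≤ l) :
    sigmaNoise w k ≤ sigmaNoise w l :=
  iSup_mono fun _ => iSup_mono' fun hj => ⟨hj.trans_le h, le_rfl⟩

theorem measurable_sigmaNoise_succ (w : ℕ → Ω → ℝ) (l : ℕ) :
    Measurable[sigmaNoise w (l + 1)] (w l) :=
  Measurable.mono (comap_measurable (w l)) (le_iSup₂_of_le l l.lt_succ_self le_rfl) le_rfl

theorem IsNoise.sigmaNoise_le {mΩ : MeasurableSpace Ω} {μ : Measure Ω} {N : ℕ} {w : ℕ → Ω → ℝ}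
    (hw : IsNoise μ N w) {k : ℕ} (hk : k ≤ N) : sigmaNoise w k ≤ mΩ :=
  iSup₂_le fun l hl => (hw.measurable l (hl.trans_le hk)).comap_le

end Noise

/-! ### Uniform form, existence and symmetry for the Riccati-like equations and the LMEIs -/

namespace Data

variable {n m : ℕ} (S : Data n m) {P : ℕ → ℕ → Matrix (Fin n) (Fin n) ℝ}

/-- The coefficient of the quadratic form in `E[X_k | ℱ_{max(k-i,t)}]` produced by one backward
step, before the control is optimised. -/
def pre (P : ℕ → ℕ → Matrix (Fin n) (Fin n) ℝ) (i k : ℕ) : Matrix (Fin n) (Fin n) ℝ :=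
  if i = 0 then S.rhs P k
  else if i + 1 ≤ S.topWH k then (S.A k)ᵀ * P (i + 1) (k + 1) * S.A k else 0

variable {S}

theorem topWH_eq_top_succ {k : ℕ} (hd : 2 ≤ S.d) : S.topWH k = S.top (k + 1) := by
  unfold topWH top; split_ifs <;> omega

theorem one_le_topWH {k : ℕ} (hd : 2 ≤ S.d) (hk : S.t ≤ k) : 1 ≤ S.topWH k := by
  unfold topWH; split_ifs <;> omega

theorem topWH_le_top_add_one {k : ℕ} (hk : S.t ≤ k) : S.topWH k ≤ S.top k + 1 := by
  unfold topWH top; split_ifs <;> omega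

theorem top_le (k : ℕ) : S.top k ≤ S.d := by
  unfold top; split_ifs <;> omega

/-- The estimate of last index `top k` is thus the one conditioned on the controller's information.
-/
theorem max_sub_top (k : ℕ) (hk : S.t ≤ k) : max (k - S.top k) S.t = max (k - S.d) S.t := by
  unfold top; split_ifs <;> omega

/-- The three time regimes obey one rule: propagate by `pre` and subtract `corr` at the last index
only. Later arguments need no case distinction in time. -/
theorem IsRiccati.eq_pre_sub (hP : S.IsRiccati P) (hd : 2 ≤ S.d) {k : ℕ} (hk : S.t ≤ k)
    (hkN : k < S.N) {i : ℕ} (hi : i ≤ S.top k) :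
    P i k = S.pre P i k - if i = S.top k then S.corr P k else 0 := by
  by_cases h : S.t + S.d ≤ k
  · have ht : S.top k = S.d := by simp [top, h]
    have htW : S.topWH k = S.d := by simp [topWH, h]
    rw [ht] at hi ⊢
    simp only [pre, htW]
    rcases Nat.eq_zero_or_pos i with rfl | h0
    · simpa [show (0 : ℕ) ≠ S.d by omega] using hP.late_zero k h hkN
    · rcases hi.eq_or_lt with rfl | hlt
      · simpa [h0.ne'] using hP.late_last k h hkN
      · simpa [h0.ne', hlt.ne, show i + 1 ≤ S.d from hlt] using
          hP.late_mid k h hkN i h0 (by omega)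
  · have ht : S.top k = k - S.t := by simp [top, h]
    have htW : S.topWH k = k + 1 - S.t := by simp [topWH, h]
    rw [ht] at hi ⊢
    simp only [pre, htW]
    rcases Nat.eq_zero_or_pos i with rfl | h0
    · rcases hk.eq_or_lt with rfl | hlt
      · simpa using hP.initial
      · simpa [show (0 : ℕ) ≠ k - S.t by omega] using hP.early_zero k hlt (by omega) hkN
    · rcases hi.eq_or_lt with rfl | hlt
      · have h3 : k - S.t + 1 = k + 1 - S.t := by omega
        simpa [h0.ne', h3] using hP.early_last k (by omega) (by omega) hkN
      · simpa [h0.ne', hlt.ne, show i + 1 ≤ k + 1 - S.t by omega] using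
          hP.early_mid k (by omega) (by omega) hkN i h0 (by omega)

theorem IsRiccati.of_eq_pre_sub (htN : S.t < S.N) (hd : 2 ≤ S.d) (h0 : P 0 S.N = S.G)
    (h1 : ∀ j, 1 ≤ j → j ≤ S.d → P j S.N = 0)
    (h : ∀ k, S.t ≤ k → k < S.N → ∀ i ≤ S.top k,
      P i k = S.pre P i k - if i = S.top k then S.corr P k else 0) : S.IsRiccati P := by
  have late : ∀ k, S.t + S.d ≤ k → S.top k = S.d ∧ S.topWH k = S.d := fun k hk => by
    simp [top, topWH, hk]
  have early : ∀ k, k < S.t + S.d → S.top k = k - S.t ∧ S.topWH k = k + 1 - S.t := fun k hk => by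
    simp [top, topWH, hk]
  refine ⟨h0, h1, fun k hk hN => ?_, fun k hk hN i hi hi' => ?_, fun k hk hN => ?_,
    fun k hk hk' hN => ?_, fun k hk hk' hN i hi hi' => ?_, fun k hk hk' hN => ?_, ?_⟩
  · have := h k (by omega) hN 0 (Nat.zero_le _)
    rw [(late k hk).1, if_neg (by omega)] at this
    simpa [pre] using this
  · have := h k (by omega) hN i (by rw [(late k hk).1]; omega)
    rw [(late k hk).1, if_neg (by omega), pre, if_neg (by omega), (late k hk).2,
      if_pos (by omega)] at this
    simpa using this
  · have := h k (by omega) hN S.d (by rw [(late k hk).1])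
    rw [(late k hk).1, if_pos rfl, pre, if_neg (by omega), (late k hk).2,
      if_neg (by omega)] at this
    simpa using this
  · have := h k (by omega) hN 0 (Nat.zero_le _)
    rw [(early k hk').1, if_neg (by omega)] at this
    simpa [pre] using this
  · have := h k (by omega) hN i (by rw [(early k hk').1]; omega)
    rw [(early k hk').1, if_neg (by omega), pre, if_neg (by omega), (early k hk').2,
      if_pos (by omega)] at this
    simpa using this
  · have := h k (by omega) hN (k - S.t) (by rw [(early k hk').1])
    rw [(early k hk').1, if_pos rfl, pre, if_neg (by omega), (early k hk').2,
      if_pos (by omega), show k - S.t + 1 = k + 1 - S.t by omega] at this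
    exact this
  · have := h S.t le_rfl htN 0 (Nat.zero_le _)
    rw [(early S.t (by omega)).1, if_pos (by omega)] at this
    simpa [pre] using this

/-- Backward recursion for the Riccati-like equations: `riccatiAux S s i` is `P^{(i)}_{N-s}`. -/
noncomputable def riccatiAux (S : Data n m) : ℕ → ℕ → Matrix (Fin n) (Fin n) ℝ
  | 0, i => if i = 0 then S.G else 0
  | s + 1, i => S.pre (fun j _ => riccatiAux S s j) i (S.N - (s + 1))
      - if i = S.top (S.N - (s + 1)) then
          S.corr (fun j _ => riccatiAux S s j) (S.N - (s + 1)) else 0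

theorem exists_isRiccati (htN : S.t < S.N) (hd : 2 ≤ S.d) : ∃ P, S.IsRiccati P := by
  refine ⟨fun i k => riccatiAux S (S.N - k) i, IsRiccati.of_eq_pre_sub htN hd ?_ ?_ ?_⟩
  · simp [riccatiAux]
  · intro j hj _
    simp [riccatiAux, show j ≠ 0 by omega]
  · intro k _ hkN i _
    obtain ⟨s, hs⟩ : ∃ s, S.N - k = s + 1 := ⟨S.N - k - 1, by omega⟩
    have h1 : S.N - (s + 1) = k := by omega
    have h2 : S.N - (k + 1) = s := by omega
    simp only [hs, riccatiAux, h1]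
    -- `pre` and `corr` read the family only at time k + 1, so the recursion could pass them a
    -- family constant in time.
    simp only [pre, corr, W, H, rhs, h2]

theorem W_isSymm (hd : 2 ≤ S.d) {k : ℕ} (hR : (S.R k).IsSymm)
    (hP : ∀ i ≤ S.top (k + 1), (P i (k + 1)).IsSymm) : (S.W P k).IsSymm := by
  have h : (∑ i ∈ Finset.range (S.topWH k + 1), (S.B k)ᵀ * P i (k + 1) * S.B k).IsSymm := by
    rw [Matrix.IsSymm, transpose_sum]
    refine Finset.sum_congr rfl fun i hi => isSymm_transpose_mul_mul (hP i ?_) _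
    rw [Finset.mem_range, topWH_eq_top_succ hd] at hi
    omega
  exact (hR.add h).add (isSymm_transpose_mul_mul (hP 0 (Nat.zero_le _)) _)

theorem pre_isSymm (hd : 2 ≤ S.d) {k : ℕ} (hk : S.t ≤ k) (hQ : (S.Q k).IsSymm)
    (hP : ∀ i ≤ S.top (k + 1), (P i (k + 1)).IsSymm) (i : ℕ) : (S.pre P i k).IsSymm := by
  rw [← topWH_eq_top_succ hd] at hP
  unfold pre
  split_ifs with h1 h2
  · exact (hQ.add (isSymm_transpose_mul_mul ((hP 0 (Nat.zero_le _)).add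
      (hP 1 (one_le_topWH hd hk))) _)).add (isSymm_transpose_mul_mul (hP 0 (Nat.zero_le _)) _)
  · exact isSymm_transpose_mul_mul (hP _ h2) _
  · exact isSymm_zero

theorem IsRiccati.isSymm (hP : S.IsRiccati P) (hd : 2 ≤ S.d)
    (hQ : ∀ k, S.t ≤ k → k < S.N → (S.Q k).IsSymm)
    (hR : ∀ k, S.t ≤ k → k < S.N → (S.R k).IsSymm) (hG : S.G.IsSymm) {k : ℕ} (hk : S.t ≤ k)
    (hkN : k ≤ S.N) : ∀ i ≤ S.top k, (P i k).IsSymm := by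
  induction hkN using Nat.decreasingInduction with
  | self =>
    intro i hi
    rcases Nat.eq_zero_or_pos i with rfl | h0
    · rwa [hP.terminal_zero]
    · rw [hP.terminal i h0 (hi.trans (top_le _))]
      exact isSymm_zero
  | of_succ k hkN ih =>
    have ih := ih (by omega)
    intro i hi
    rw [hP.eq_pre_sub hd hk hkN hi]
    refine (pre_isSymm hd hk (hQ k hk hkN) ih i).sub ?_
    split_ifs
    · exact isSymm_transpose_mul_mul (pinv_isSymm (W_isSymm hd (hR k hk hkN) ih)) _
    · exact isSymm_zero

/-- The inequalities hold with difference zero, and each block inequality has upper left corner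
HᵀW†H, the case of `posSemidef_fromBlocks_pinv`. -/
theorem IsRiccati.isLMEI (hP : S.IsRiccati P) (htN : S.t < S.N) (hd : 2 ≤ S.d)
    (hC : S.Constraint P) : S.IsLMEI P := by
  have key : ∀ k, S.t ≤ k → k < S.N →
      (fromBlocks (S.corr P k) (S.H P k)ᵀ (S.H P k) (S.W P k)).PosSemidef := fun k hk hkN =>
    posSemidef_fromBlocks_pinv (hC k hk hkN).2 (hC k hk hkN).1
  refine ⟨?_, hP.terminal, ?_, hP.late_mid, ?_, ?_, hP.early_mid, ?_, ?_⟩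
  · rw [hP.terminal_zero, sub_self]; exact PosSemidef.zero
  · intro k hk hkN
    rw [hP.late_zero k hk hkN, sub_self]; exact PosSemidef.zero
  · intro k hk hkN
    rw [hP.late_last k hk hkN, neg_neg]; exact key k (by omega) hkN
  · intro k hk hk' hkN
    rw [hP.early_zero k hk hk' hkN, sub_self]; exact PosSemidef.zero
  · intro k hk hk' hkN
    rw [hP.early_last k hk hk' hkN, sub_sub_cancel]; exact key k (by omega) hkN
  · rw [hP.initial, sub_sub_cancel]; exact key S.t le_rfl htN

theorem IsLMEI.pre_sub_posSemidef (hP : S.IsLMEI P) {k : ℕ}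
    (hkN : k < S.N) {i : ℕ} (hi : i < S.top k) : (S.pre P i k - P i k).PosSemidef := by
  by_cases h : S.t + S.d ≤ k
  · have ht : S.top k = S.d := by simp [top, h]
    have htW : S.topWH k = S.d := by simp [topWH, h]
    rw [ht] at hi
    simp only [pre, htW]
    rcases Nat.eq_zero_or_pos i with rfl | h0
    · simpa using hP.late_zero k h hkN
    · rw [if_neg h0.ne', if_pos (by omega), hP.late_mid k h hkN i h0 (by omega), sub_self]
      exact PosSemidef.zero
  · have ht : S.top k = k - S.t := by simp [top, h]
    have htW : S.topWH k = k + 1 - S.t := by simp [topWH, h]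
    rw [ht] at hi
    simp only [pre, htW]
    rcases Nat.eq_zero_or_pos i with rfl | h0
    · simpa using hP.early_zero k (by omega) (by omega) hkN
    · rw [if_neg h0.ne', if_pos (by omega),
        hP.early_mid k (by omega) (by omega) hkN i h0 (by omega), sub_self]
      exact PosSemidef.zero

theorem IsLMEI.fromBlocks_posSemidef (hP : S.IsLMEI P) (hd : 2 ≤ S.d) {k : ℕ} (hk : S.t ≤ k)
    (hkN : k < S.N) :
    (fromBlocks (S.pre P (S.top k) k - P (S.top k) k) (S.H P k)ᵀ (S.H P k)
      (S.W P k)).PosSemidef := by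
  by_cases h : S.t + S.d ≤ k
  · have ht : S.top k = S.d := by simp [top, h]
    have htW : S.topWH k = S.d := by simp [topWH, h]
    rw [ht, pre, htW, if_neg (by omega), if_neg (by omega), zero_sub]
    exact hP.late_last k h hkN
  · have ht : S.top k = k - S.t := by simp [top, h]
    have htW : S.topWH k = k + 1 - S.t := by simp [topWH, h]
    rw [ht, pre, htW]
    rcases hk.eq_or_lt with rfl | hlt
    · simpa using hP.initial
    · rw [if_neg (by omega), if_pos (by omega), show k - S.t + 1 = k + 1 - S.t by omega]
      exact hP.early_last k hlt (by omega) hkN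

/-- Symmetry is not imposed on the unknowns. It propagates backwards, since a semidefinite
difference is symmetric and `pre` is symmetric by induction. -/
theorem IsLMEI.isSymm (hP : S.IsLMEI P) (hd : 2 ≤ S.d)
    (hQ : ∀ k, S.t ≤ k → k < S.N → (S.Q k).IsSymm) (hG : S.G.IsSymm) {k : ℕ} (hk : S.t ≤ k)
    (hkN : k ≤ S.N) : ∀ i ≤ S.top k, (P i k).IsSymm := by
  have sub : ∀ {M M' : Matrix (Fin n) (Fin n) ℝ}, M.IsSymm → (M - M').IsHermitian →
      M'.IsSymm := fun {M M'} h h' => by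
    have h'' : (M - M').IsSymm := by simpa using h'
    simpa using h.sub h''
  induction hkN using Nat.decreasingInduction with
  | self =>
    intro i hi
    rcases Nat.eq_zero_or_pos i with rfl | h0
    · exact sub hG hP.terminal_zero.isHermitian
    · rw [hP.terminal i h0 (hi.trans (top_le _))]
      exact isSymm_zero
  | of_succ k hkN ih =>
    intro i hi
    refine sub (pre_isSymm hd hk (hQ k hk hkN) (ih (by omega)) i) ?_
    rcases hi.eq_or_lt with rfl | hlt
    · exact (isHermitian_fromBlocks_iff.1 (hP.fromBlocks_posSemidef hd hk hkN).isHermitian).1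
    · exact (hP.pre_sub_posSemidef hkN hlt).isHermitian

end Data

end DelayLQ

/-! ### Delayed estimates and the one-step energy identity -/

namespace DelayLQ

namespace Data

variable {n m : ℕ} {S : Data n m} {P : ℕ → ℕ → Matrix (Fin n) (Fin n) ℝ}
  {Ω : Type*} {mΩ : MeasurableSpace Ω} {μ : Measure Ω} {w : ℕ → Ω → ℝ}

/-- The projection `E[X | ℱ_{max(l-i,t)}]`. -/
noncomputable def proj (S : Data n m) (μ : Measure Ω) (w : ℕ → Ω → ℝ) (l i : ℕ)
    (X : Ω → Fin n → ℝ) : Ω → Fin n → ℝ :=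
  condExp (sigmaNoise w (max (l - i) S.t)) μ X

/-- `∑_i E[Y_iᵀ P_i Y_i]` with `Y_i = E[X | ℱ_{max(l-i,t)}]`. -/
noncomputable def energy (S : Data n m) (μ : Measure Ω) (w : ℕ → Ω → ℝ)
    (P : ℕ → Matrix (Fin n) (Fin n) ℝ) (l : ℕ) (X : Ω → Fin n → ℝ) : ℝ :=
  ∑ i ∈ Finset.range (S.top l + 1), qexp μ (P i) (S.proj μ w l i X) (S.proj μ w l i X)

/-- The cost incurred at time `l`. -/
noncomputable def stage (S : Data n m) (μ : Measure Ω) (l : ℕ) (X : Ω → Fin n → ℝ)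
    (u : Ω → Fin m → ℝ) : ℝ :=
  qexp μ (S.Q l) X X + qexp μ (S.R l) u u

theorem memLp_proj {X : Ω → Fin n → ℝ} (hX : MemLp X 2 μ) (l i : ℕ) :
    MemLp (S.proj μ w l i X) 2 μ :=
  hX.condExp one_le_two

theorem proj_zero [IsFiniteMeasure μ] (hw : IsNoise μ S.N w) {l : ℕ} (hl : S.t ≤ l)
    (hlN : l ≤ S.N) {X : Ω → Fin n → ℝ} (hXm : StronglyMeasurable[sigmaNoise w l] X)
    (hX : MemLp X 2 μ) : S.proj μ w l 0 X = X := by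
  rw [proj, Nat.sub_zero, max_eq_left hl]
  exact condExp_of_stronglyMeasurable (hw.sigmaNoise_le hlN) hXm (hX.integrable one_le_two)

theorem proj_const [IsProbabilityMeasure μ] (htN : S.t < S.N) (hw : IsNoise μ S.N w) {l : ℕ}
    (hlN : l ≤ S.N) (i : ℕ) (ξ : Fin n → ℝ) : S.proj μ w l i (fun _ => ξ) = fun _ => ξ :=
  condExp_const (hw.sigmaNoise_le (by omega)) ξ

theorem proj_top {l : ℕ} (hl : S.t ≤ l) (X : Ω → Fin n → ℝ) :
    S.proj μ w l (S.top l) X = condExp (S.info w l) μ X := by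
  rw [proj, max_sub_top l hl]

theorem qexp_const [IsProbabilityMeasure μ] {p q : ℕ} (M : Matrix (Fin p) (Fin q) ℝ)
    (x : Fin p → ℝ) (y : Fin q → ℝ) :
    qexp μ M (fun _ => x) (fun _ => y) = x ⬝ᵥ (M *ᵥ y) := by
  simp [qexp]

theorem energy_const [IsProbabilityMeasure μ] (htN : S.t < S.N) (hw : IsNoise μ S.N w)
    (M : ℕ → Matrix (Fin n) (Fin n) ℝ) {l : ℕ} (hlN : l ≤ S.N) (ξ : Fin n → ℝ) :
    S.energy μ w M l (fun _ => ξ) = ∑ i ∈ Finset.range (S.top l + 1), ξ ⬝ᵥ (M i *ᵥ ξ) := by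
  simp only [energy, proj_const htN hw hlN, qexp_const]

section Step

variable {l : ℕ} {X : Ω → Fin n → ℝ} {u : Ω → Fin m → ℝ}

/-- One step of the dynamics. -/
def next (S : Data n m) (w : ℕ → Ω → ℝ) (l : ℕ) (X : Ω → Fin n → ℝ) (u : Ω → Fin m → ℝ) :
    Ω → Fin n → ℝ := fun ω =>
  (S.A l *ᵥ X ω + S.B l *ᵥ u ω) + w l ω • (S.C l *ᵥ X ω + S.D l *ᵥ u ω)

theorem stronglyMeasurable_affine {F : MeasurableSpace Ω} (hXm : StronglyMeasurable[F] X)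
    (hum : StronglyMeasurable[F] u) (A : Matrix (Fin n) (Fin n) ℝ)
    (B : Matrix (Fin n) (Fin m) ℝ) :
    StronglyMeasurable[F] (fun ω => A *ᵥ X ω + B *ᵥ u ω) :=
  (StronglyMeasurable.mulVec hXm A).add (StronglyMeasurable.mulVec hum B)

theorem memLp_affine (hX : MemLp X 2 μ) (hu : MemLp u 2 μ) (A : Matrix (Fin n) (Fin n) ℝ)
    (B : Matrix (Fin n) (Fin m) ℝ) : MemLp (fun ω => A *ᵥ X ω + B *ᵥ u ω) 2 μ :=
  (MemLp.mulVec hX A).add (MemLp.mulVec hu B)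

theorem info_le (hl : S.t ≤ l) : S.info w l ≤ sigmaNoise w l :=
  sigmaNoise_mono w (by omega)

theorem stronglyMeasurable_next (hl : S.t ≤ l)
    (hXm : StronglyMeasurable[sigmaNoise w l] X) (hum : StronglyMeasurable[S.info w l] u) :
    StronglyMeasurable[sigmaNoise w (l + 1)] (S.next w l X u) := by
  have h := sigmaNoise_mono w l.le_succ
  have hum' := hum.mono (info_le hl)
  exact ((stronglyMeasurable_affine hXm hum' _ _).mono h).add
    ((measurable_sigmaNoise_succ w l).stronglyMeasurable.smul
      ((stronglyMeasurable_affine hXm hum' _ _).mono h))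

theorem memLp_next [IsFiniteMeasure μ] (hw : IsNoise μ S.N w) (hl : S.t ≤ l) (hlN : l < S.N)
    (hXm : StronglyMeasurable[sigmaNoise w l] X) (hX : MemLp X 2 μ)
    (hum : StronglyMeasurable[S.info w l] u) (hu : MemLp u 2 μ) : MemLp (S.next w l X u) 2 μ :=
  (memLp_affine hX hu _ _).add (memLp_smul_of_condExp_sq (hw.sigmaNoise_le hlN.le)
    (hw.memLp l hlN) (hw.condExp_sq_eq_one l hlN)
    (stronglyMeasurable_affine hXm (hum.mono (info_le hl)) _ _) (memLp_affine hX hu _ _))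

/-- Both sides condition on the same σ-algebra, as (l+1) - (i+1) = l - i. This index shift is why
P^{(i+1)}_{k+1} feeds P^{(i)}_k. -/
theorem proj_next [IsFiniteMeasure μ] (hw : IsNoise μ S.N w) (hl : S.t ≤ l) (hlN : l < S.N)
    (hXm : StronglyMeasurable[sigmaNoise w l] X) (hX : MemLp X 2 μ)
    (hum : StronglyMeasurable[S.info w l] u) (hu : MemLp u 2 μ)
    {i : ℕ} (hi : i ≤ S.top l) :
    S.proj μ w (l + 1) (i + 1) (S.next w l X u)
      =ᵐ[μ] fun ω => S.A l *ᵥ S.proj μ w l i X ω + S.B l *ᵥ u ω := by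
  have hF := hw.sigmaNoise_le hlN.le
  have hle : sigmaNoise w (max (l - i) S.t) ≤ sigmaNoise w l := sigmaNoise_mono w (by omega)
  have hum' := hum.mono (info_le hl)
  have hZ : StronglyMeasurable[sigmaNoise w l] (fun ω => S.C l *ᵥ X ω + S.D l *ᵥ u ω) :=
    stronglyMeasurable_affine hXm hum' _ _
  have hwZ := memLp_smul_of_condExp_sq hF (hw.memLp l hlN) (hw.condExp_sq_eq_one l hlN) hZ
    (memLp_affine hX hu _ _)
  have hAX := MemLp.mulVec hX (S.A l)
  have hBu := MemLp.mulVec hu (S.B l)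
  -- For i ≤ `top l` this σ-algebra contains the controller's information.
  have hu_info : StronglyMeasurable[sigmaNoise w (max (l - i) S.t)] u :=
    hum.mono (sigmaNoise_mono w (by have := max_sub_top (S := S) l hl; omega))
  rw [proj, Nat.add_sub_add_right]
  have e1 := condExp_add ((hAX.add hBu).integrable one_le_two) (hwZ.integrable one_le_two)
    (sigmaNoise w (max (l - i) S.t))
  have e2 := condExp_add (hAX.integrable one_le_two) (hBu.integrable one_le_two)
    (sigmaNoise w (max (l - i) S.t))
  have e3 := condExp_smul_eq_zero (hw.memLp l hlN) hF hle (hw.condExp_eq_zero l hlN) hZ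
    (hwZ.integrable one_le_two)
  have e4 := condExp_mulVec (F := sigmaNoise w (max (l - i) S.t))
    (hX.integrable one_le_two) (S.A l)
  have e5 : μ[fun ω => S.B l *ᵥ u ω | sigmaNoise w (max (l - i) S.t)] = fun ω => S.B l *ᵥ u ω :=
    condExp_of_stronglyMeasurable (hle.trans hF) (StronglyMeasurable.mulVec hu_info _)
      (hBu.integrable one_le_two)
  refine Filter.EventuallyEq.trans e1 ?_
  filter_upwards [e2, e3, e4] with ω h2 h3 h4
  rw [Pi.add_apply, h2, h3, add_zero, Pi.add_apply, h4, e5]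
  rfl

/-- All cross terms of u with an estimate reduce to the cross term with X, so their coefficients add
up to the single matrix H. -/
theorem qexp_proj_right [IsFiniteMeasure μ] (hw : IsNoise μ S.N w) (hl : S.t ≤ l) (hlN : l < S.N)
    (hX : MemLp X 2 μ) (hum : StronglyMeasurable[S.info w l] u) (hu : MemLp u 2 μ)
    (M : Matrix (Fin m) (Fin n) ℝ) {i : ℕ} (hi : i ≤ S.top l) :
    qexp μ M u (S.proj μ w l i X) = qexp μ M u X := by
  refine qexp_condExp_right (hw.sigmaNoise_le (by omega)) (hum.mono (sigmaNoise_mono w ?_)) hu hX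
  have := max_sub_top (S := S) l hl
  omega

/-- The basic energy identity for one step of the dynamics. -/
theorem stage_add_energy_next [IsFiniteMeasure μ] (hw : IsNoise μ S.N w) (hl : S.t ≤ l) (hlN : l < S.N)
    (hXm : StronglyMeasurable[sigmaNoise w l] X) (hX : MemLp X 2 μ)
    (hum : StronglyMeasurable[S.info w l] u) (hu : MemLp u 2 μ)
    (hd : 2 ≤ S.d)
    (hP : ∀ i ≤ S.top (l + 1), (P i (l + 1)).IsSymm) :
    S.stage μ l X u + S.energy μ w (fun i => P i (l + 1)) (l + 1) (S.next w l X u)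
      = S.energy μ w (fun i => S.pre P i l) l X + qexp μ (S.W P l) u u
        + 2 * qexp μ (S.H P l) u (condExp (S.info w l) μ X) := by
  have hF := hw.sigmaNoise_le hlN.le
  have hum' := hum.mono (info_le hl)
  have hnm := stronglyMeasurable_next hl hXm hum
  have hn := memLp_next hw hl hlN hXm hX hum hu
  have hHu : qexp μ (S.H P l) u (condExp (S.info w l) μ X) = qexp μ (S.H P l) u X := by
    rw [← proj_top hl, qexp_proj_right hw hl hlN hX hum hu _ le_rfl]
  have hz : qexp μ (P 0 (l + 1)) (S.proj μ w (l + 1) 0 (S.next w l X u))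
      (S.proj μ w (l + 1) 0 (S.next w l X u)) =
      (qexp μ ((S.A l)ᵀ * P 0 (l + 1) * S.A l) X X
        + 2 * qexp μ ((S.B l)ᵀ * P 0 (l + 1) * S.A l) u X
        + qexp μ ((S.B l)ᵀ * P 0 (l + 1) * S.B l) u u)
      + (qexp μ ((S.C l)ᵀ * P 0 (l + 1) * S.C l) X X
        + 2 * qexp μ ((S.D l)ᵀ * P 0 (l + 1) * S.C l) u X
        + qexp μ ((S.D l)ᵀ * P 0 (l + 1) * S.D l) u u) := by
    rw [proj_zero hw (by omega) hlN hnm hn, ← qexp_affine (hP 0 (Nat.zero_le _)) _ _ hX hu,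
      ← qexp_affine (hP 0 (Nat.zero_le _)) _ _ hX hu]
    exact qexp_add_smul hF (hw.memLp l hlN) (hw.condExp_eq_zero l hlN)
      (hw.condExp_sq_eq_one l hlN) (stronglyMeasurable_affine hXm hum' _ _)
      (memLp_affine hX hu _ _) (stronglyMeasurable_affine hXm hum' _ _) (memLp_affine hX hu _ _)
  have hs : ∀ i ∈ Finset.range (S.topWH l),
      qexp μ (P (i + 1) (l + 1)) (S.proj μ w (l + 1) (i + 1) (S.next w l X u))
        (S.proj μ w (l + 1) (i + 1) (S.next w l X u)) =
      qexp μ ((S.A l)ᵀ * P (i + 1) (l + 1) * S.A l) (S.proj μ w l i X) (S.proj μ w l i X)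
        + 2 * qexp μ ((S.B l)ᵀ * P (i + 1) (l + 1) * S.A l) u X
        + qexp μ ((S.B l)ᵀ * P (i + 1) (l + 1) * S.B l) u u := by
    intro i hi
    have hi := Finset.mem_range.1 hi
    have hi' : i ≤ S.top l := by have := topWH_le_top_add_one (S := S) hl; omega
    have e := proj_next hw hl hlN hXm hX hum hu hi'
    rw [qexp_congr e e, qexp_affine (hP _ (by rw [← topWH_eq_top_succ hd]; omega)) _ _
      (memLp_proj hX l i) hu, qexp_proj_right hw hl hlN hX hum hu _ hi']
  -- Both P^{(0)} and P^{(1)} land on Y_0 = X, whence their sum in `rhs`.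
  have hpre : S.energy μ w (fun i => S.pre P i l) l X
      = qexp μ (S.Q l) X X + qexp μ ((S.A l)ᵀ * P 0 (l + 1) * S.A l) X X
        + qexp μ ((S.C l)ᵀ * P 0 (l + 1) * S.C l) X X
        + ∑ i ∈ Finset.range (S.topWH l), qexp μ ((S.A l)ᵀ * P (i + 1) (l + 1) * S.A l)
          (S.proj μ w l i X) (S.proj μ w l i X) := by
    have h0 := proj_zero hw hl hlN.le hXm hX
    obtain ⟨r, hr⟩ : ∃ r, S.topWH l = r + 1 :=
      ⟨S.topWH l - 1, by have := one_le_topWH (S := S) hd hl; omega⟩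
    -- For l ≥ t + d the index d has no successor at time l + 1; there `pre` is zero and the ranges
    -- differ by that one term.
    have hsum : ∑ i ∈ Finset.range r, qexp μ ((S.A l)ᵀ * P (i + 1 + 1) (l + 1) * S.A l)
          (S.proj μ w l (i + 1) X) (S.proj μ w l (i + 1) X)
        = ∑ i ∈ Finset.range (S.top l), qexp μ (S.pre P (i + 1) l)
          (S.proj μ w l (i + 1) X) (S.proj μ w l (i + 1) X) := by
      have hle : r ≤ S.top l := by have := topWH_le_top_add_one (S := S) hl; omega
      rw [← Finset.sum_subset (Finset.range_subset_range.2 hle)]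
      · refine Finset.sum_congr rfl fun i hi => ?_
        rw [Finset.mem_range] at hi
        rw [pre, if_neg (Nat.succ_ne_zero i), if_pos (by omega)]
      · intro i _ hi
        rw [Finset.mem_range] at hi
        rw [pre, if_neg (Nat.succ_ne_zero i), if_neg (by omega), qexp_zero]
    rw [energy, Finset.sum_range_succ', hr, Finset.sum_range_succ', hsum, h0]
    simp only [pre, if_true, rhs, Matrix.mul_add, Matrix.add_mul, qexp_add hX hX, Nat.zero_add]
    ring
  rw [hHu, hpre, stage, energy, ← topWH_eq_top_succ hd, Finset.sum_range_succ', hz,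
    Finset.sum_congr rfl hs, W, H, Finset.sum_range_succ', Finset.sum_range_succ']
  simp only [qexp_add hu hu, qexp_add hu hX, qexp_sum _ _ hu hu, qexp_sum _ _ hu hX,
    Finset.sum_add_distrib, ← Finset.mul_sum]
  ring

end Step

end Data

end DelayLQ

/-! ### The cost along a trajectory, and its lower bound from the LMEIs -/

namespace DelayLQ

namespace Data

variable {n m : ℕ} {S : Data n m} {P : ℕ → ℕ → Matrix (Fin n) (Fin n) ℝ}
  {Ω : Type*} {mΩ : MeasurableSpace Ω} {μ : Measure Ω} {w : ℕ → Ω → ℝ}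

theorem state_of_le {k l : ℕ} (hl : l ≤ k) (ξ : Fin n → ℝ) (u : ℕ → Ω → Fin m → ℝ) :
    S.state w k ξ u l = fun _ => ξ := by
  cases l with
  | zero => rfl
  | succ l => rw [state, if_pos (by omega)]

theorem state_succ {k l : ℕ} (hl : k ≤ l) (ξ : Fin n → ℝ) (u : ℕ → Ω → Fin m → ℝ) :
    S.state w k ξ u (l + 1) = S.next w l (S.state w k ξ u l) (u l) := by
  rw [state, if_neg (by omega)]; rfl

/-- A control that is admissible at each time at which the state is adapted and square
integrable is admissible, and its state is adapted and square integrable. -/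
theorem admissible_and_state [IsFiniteMeasure μ] (hw : IsNoise μ S.N w) {k : ℕ} (hk : S.t ≤ k)
    {ξ : Fin n → ℝ} {u : ℕ → Ω → Fin m → ℝ}
    (h : ∀ l, k ≤ l → l < S.N → StronglyMeasurable[sigmaNoise w l] (S.state w k ξ u l) →
      MemLp (S.state w k ξ u l) 2 μ → StronglyMeasurable[S.info w l] (u l) ∧ MemLp (u l) 2 μ) :
    u ∈ S.admissible μ w k ∧ ∀ l, k ≤ l → l ≤ S.N →
      StronglyMeasurable[sigmaNoise w l] (S.state w k ξ u l) ∧ MemLp (S.state w k ξ u l) 2 μ := by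
  have key : ∀ l, k ≤ l → l ≤ S.N →
      StronglyMeasurable[sigmaNoise w l] (S.state w k ξ u l) ∧
        MemLp (S.state w k ξ u l) 2 μ := by
    intro l hl
    induction l, hl using Nat.le_induction with
    | base =>
      intro _
      rw [state_of_le le_rfl]
      exact ⟨stronglyMeasurable_const, memLp_const ξ⟩
    | succ l hl ih =>
      intro hlN
      obtain ⟨hXm, hX⟩ := ih (by omega)
      obtain ⟨hum, hu⟩ := h l hl hlN hXm hX
      rw [state_succ hl]
      exact ⟨stronglyMeasurable_next (hk.trans hl) hXm hum,
        memLp_next hw (hk.trans hl) hlN hXm hX hum hu⟩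
  exact ⟨fun l hl hlN => h l hl hlN (key l hl hlN.le).1 (key l hl hlN.le).2, key⟩

theorem stronglyMeasurable_state [IsFiniteMeasure μ] (hw : IsNoise μ S.N w) {k : ℕ}
    (hk : S.t ≤ k) {u : ℕ → Ω → Fin m → ℝ} (hu : u ∈ S.admissible μ w k) (ξ : Fin n → ℝ) {l : ℕ}
    (hl : k ≤ l) (hlN : l ≤ S.N) : StronglyMeasurable[sigmaNoise w l] (S.state w k ξ u l) :=
  ((admissible_and_state hw hk fun l hl hlN _ _ => hu l hl hlN).2 l hl hlN).1

theorem memLp_state [IsFiniteMeasure μ] (hw : IsNoise μ S.N w) {k : ℕ}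
    (hk : S.t ≤ k) {u : ℕ → Ω → Fin m → ℝ} (hu : u ∈ S.admissible μ w k) (ξ : Fin n → ℝ) {l : ℕ}
    (hl : k ≤ l) (hlN : l ≤ S.N) : MemLp (S.state w k ξ u l) 2 μ :=
  ((admissible_and_state hw hk fun l hl hlN _ _ => hu l hl hlN).2 l hl hlN).2

theorem cost_eq [IsFiniteMeasure μ] (hw : IsNoise μ S.N w) {k : ℕ}
    (hk : S.t ≤ k) {u : ℕ → Ω → Fin m → ℝ} (hu : u ∈ S.admissible μ w k) (ξ : Fin n → ℝ) :
    S.cost μ w k ξ u = (∑ l ∈ Finset.Ico k S.N, S.stage μ l (S.state w k ξ u l) (u l))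
      + qexp μ S.G (S.state w k ξ u S.N) (S.state w k ξ u S.N) := by
  rw [cost]
  congr 1
  refine Finset.sum_congr rfl fun l hl => ?_
  obtain ⟨hl, hlN⟩ := Finset.mem_Ico.1 hl
  have hX := memLp_state hw hk hu ξ hl hlN.le
  exact integral_add (integrable_dotProduct_mulVec hX hX)
    (integrable_dotProduct_mulVec (hu l hl hlN).2 (hu l hl hlN).2)

/-- `E[(u + W† H y)ᵀ W (u + W† H y)]` with `y = E[X | info]`: the excess cost at time `l`. -/
noncomputable def excess (S : Data n m) (μ : Measure Ω) (w : ℕ → Ω → ℝ)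
    (P : ℕ → ℕ → Matrix (Fin n) (Fin n) ℝ) (l : ℕ) (X : Ω → Fin n → ℝ) (u : Ω → Fin m → ℝ) : ℝ :=
  qexp μ (S.W P l) (fun ω => u ω - S.feedback μ w P l X ω) (fun ω => u ω - S.feedback μ w P l X ω)

/-- Completion of the square: W W† H = H turns the cross term W W† H into H and the pure y term into
HᵀW†H. -/
theorem excess_eq {l : ℕ} (hW : (S.W P l).IsSymm)
    (hH : S.W P l * pinv (S.W P l) * S.H P l = S.H P l) {X : Ω → Fin n → ℝ}
    {u : Ω → Fin m → ℝ} (hX : MemLp X 2 μ) (hu : MemLp u 2 μ) :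
    S.excess μ w P l X u = qexp μ (S.corr P l) (condExp (S.info w l) μ X)
        (condExp (S.info w l) μ X)
      + 2 * qexp μ (S.H P l) u (condExp (S.info w l) μ X) + qexp μ (S.W P l) u u := by
  have h := qexp_affine hW (pinv (S.W P l) * S.H P l) 1 (hX.condExp one_le_two (m := S.info w l)) hu
  rw [transpose_mul_mul_pinv_mul hW hH, transpose_one, Matrix.one_mul, ← Matrix.mul_assoc, hH,
    Matrix.mul_one] at h
  rw [corr, ← h, excess]
  simp only [feedback, one_mulVec, sub_neg_eq_add, add_comm]

theorem excess_feedback (l : ℕ) (X : Ω → Fin n → ℝ) :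
    S.excess μ w P l X (S.feedback μ w P l X) = 0 := by
  simp [excess, qexp]

theorem IsRiccati.energy_pre (hP : S.IsRiccati P) (hd : 2 ≤ S.d) {l : ℕ} (hl : S.t ≤ l)
    (hlN : l < S.N) {X : Ω → Fin n → ℝ} (hX : MemLp X 2 μ) :
    S.energy μ w (fun i => S.pre P i l) l X = S.energy μ w (fun i => P i l) l X
      + qexp μ (S.corr P l) (condExp (S.info w l) μ X) (condExp (S.info w l) μ X) := by
  have hlast := hP.eq_pre_sub hd hl hlN le_rfl
  rw [if_pos rfl, eq_sub_iff_add_eq] at hlast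
  rw [energy, energy, Finset.sum_range_succ, Finset.sum_range_succ, ← hlast,
    qexp_add (memLp_proj hX _ _) (memLp_proj hX _ _), proj_top hl, ← add_assoc]
  congr 2
  refine Finset.sum_congr rfl fun i hi => ?_
  have hi := Finset.mem_range.1 hi
  have := hP.eq_pre_sub hd hl hlN hi.le
  rw [if_neg hi.ne, sub_zero] at this
  rw [this]

/-- Only the range condition enters, not W ≥ 0, so the identity is available before positivity is
known. -/
theorem IsRiccati.stage_add_energy_next [IsFiniteMeasure μ] (hP : S.IsRiccati P) (hd : 2 ≤ S.d)
    (hw : IsNoise μ S.N w) {l : ℕ} (hl : S.t ≤ l) (hlN : l < S.N)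
    (hsymm : ∀ i ≤ S.top (l + 1), (P i (l + 1)).IsSymm) (hR : (S.R l).IsSymm)
    (hH : S.W P l * pinv (S.W P l) * S.H P l = S.H P l) {X : Ω → Fin n → ℝ} {u : Ω → Fin m → ℝ}
    (hXm : StronglyMeasurable[sigmaNoise w l] X) (hX : MemLp X 2 μ)
    (hum : StronglyMeasurable[S.info w l] u) (hu : MemLp u 2 μ) :
    S.stage μ l X u + S.energy μ w (fun i => P i (l + 1)) (l + 1) (S.next w l X u)
      = S.energy μ w (fun i => P i l) l X + S.excess μ w P l X u := by
  rw [Data.stage_add_energy_next hw hl hlN hXm hX hum hu hd hsymm, hP.energy_pre hd hl hlN hX,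
    excess_eq (W_isSymm hd hR hsymm) hH hX hu]
  ring

theorem energy_terminal [IsFiniteMeasure μ] (hw : IsNoise μ S.N w) (htN : S.t < S.N)
    (hP : ∀ j, 1 ≤ j → j ≤ S.d → P j S.N = 0) {X : Ω → Fin n → ℝ}
    (hXm : StronglyMeasurable[sigmaNoise w S.N] X) (hX : MemLp X 2 μ) :
    S.energy μ w (fun i => P i S.N) S.N X = qexp μ (P 0 S.N) X X := by
  rw [energy, Finset.sum_range_succ', proj_zero hw htN.le le_rfl hXm hX, Finset.sum_eq_zero,
    zero_add]
  intro i hi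
  have := top_le (S := S) S.N
  rw [hP (i + 1) (by omega) (by have := Finset.mem_range.1 hi; omega), qexp_zero]

theorem sum_Ico_add_of_succ {k N : ℕ} (hk : k ≤ N) {a b f : ℕ → ℝ}
    (h : ∀ l, k ≤ l → l < N → a l + f (l + 1) = f l + b l) :
    ∑ l ∈ Finset.Ico k N, a l + f N = f k + ∑ l ∈ Finset.Ico k N, b l := by
  induction N, hk using Nat.le_induction with
  | base => simp
  | succ N hkN ih =>
    rw [Finset.sum_Ico_succ_top hkN, Finset.sum_Ico_succ_top hkN]
    linarith [ih fun l hl hlN => h l hl (by omega), h N hkN N.lt_succ_self]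

/-- The cost from time `j` on, when the constraints hold from time `j` on. -/
theorem IsRiccati.tail_cost [IsFiniteMeasure μ] (hP : S.IsRiccati P) (htN : S.t < S.N)
    (hd : 2 ≤ S.d)
    (hw : IsNoise μ S.N w) (hsymm : ∀ l, S.t ≤ l → l ≤ S.N → ∀ i ≤ S.top l, (P i l).IsSymm)
    (hR : ∀ k, S.t ≤ k → k < S.N → (S.R k).IsSymm) {k j : ℕ} (hk : S.t ≤ k) (hkj : k ≤ j)
    (hjN : j ≤ S.N)
    (hH : ∀ l, j ≤ l → l < S.N → S.W P l * pinv (S.W P l) * S.H P l = S.H P l)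
    (ξ : Fin n → ℝ) {u : ℕ → Ω → Fin m → ℝ} (hu : u ∈ S.admissible μ w k) :
    (∑ l ∈ Finset.Ico j S.N, S.stage μ l (S.state w k ξ u l) (u l))
      + qexp μ S.G (S.state w k ξ u S.N) (S.state w k ξ u S.N)
    = S.energy μ w (fun i => P i j) j (S.state w k ξ u j)
      + ∑ l ∈ Finset.Ico j S.N, S.excess μ w P l (S.state w k ξ u l) (u l) := by
  rw [← hP.terminal_zero, ← energy_terminal hw htN hP.terminal
    (stronglyMeasurable_state hw hk hu ξ (by omega) le_rfl)
    (memLp_state hw hk hu ξ (by omega) le_rfl)]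
  refine sum_Ico_add_of_succ (f := fun l => S.energy μ w (fun i => P i l) l (S.state w k ξ u l))
    hjN fun l hl hlN => ?_
  have hkl : k ≤ l := hkj.trans hl
  rw [state_succ hkl]
  exact hP.stage_add_energy_next hd hw (hk.trans hkl) hlN
    (hsymm _ (by omega) hlN) (hR l (hk.trans hkl) hlN) (hH l hl hlN)
    (stronglyMeasurable_state hw hk hu ξ hkl hlN.le) (memLp_state hw hk hu ξ hkl hlN.le)
    (hu l hkl hlN).1 (hu l hkl hlN).2

/-- Indices below the last are compared form by form. At the last index the block inequality is
evaluated pointwise at the pair (y, u). -/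
theorem IsLMEI.le_stage_add_energy_next [IsFiniteMeasure μ] (hP : S.IsLMEI P) (hd : 2 ≤ S.d)
    (hw : IsNoise μ S.N w) {l : ℕ} (hl : S.t ≤ l) (hlN : l < S.N)
    (hsymm : ∀ i ≤ S.top (l + 1), (P i (l + 1)).IsSymm) {X : Ω → Fin n → ℝ} {u : Ω → Fin m → ℝ}
    (hXm : StronglyMeasurable[sigmaNoise w l] X) (hX : MemLp X 2 μ)
    (hum : StronglyMeasurable[S.info w l] u) (hu : MemLp u 2 μ) :
    S.energy μ w (fun i => P i l) l X ≤
      S.stage μ l X u + S.energy μ w (fun i => P i (l + 1)) (l + 1) (S.next w l X u) := by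
  rw [Data.stage_add_energy_next hw hl hlN hXm hX hum hu hd hsymm, energy, energy,
    Finset.sum_range_succ, Finset.sum_range_succ]
  have h1 : ∑ i ∈ Finset.range (S.top l), qexp μ (P i l) (S.proj μ w l i X) (S.proj μ w l i X)
      ≤ ∑ i ∈ Finset.range (S.top l),
        qexp μ (S.pre P i l) (S.proj μ w l i X) (S.proj μ w l i X) := by
    refine Finset.sum_le_sum fun i hi => ?_
    rw [← sub_nonneg, ← qexp_sub (memLp_proj hX _ _) (memLp_proj hX _ _)]
    exact qexp_nonneg (hP.pre_sub_posSemidef hlN (Finset.mem_range.1 hi)) _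
  have hy : MemLp (condExp (S.info w l) μ X) 2 μ := hX.condExp one_le_two
  have h2 : 0 ≤ qexp μ (S.pre P (S.top l) l - P (S.top l) l) (condExp (S.info w l) μ X)
        (condExp (S.info w l) μ X)
      + 2 * qexp μ (S.H P l) u (condExp (S.info w l) μ X) + qexp μ (S.W P l) u u := by
    simp only [qexp]
    have i1 := integrable_dotProduct_mulVec (P := S.pre P (S.top l) l - P (S.top l) l) hy hy
    have i2 := (integrable_dotProduct_mulVec (P := S.H P l) hu hy).const_mul 2
    have i3 := integrable_dotProduct_mulVec (P := S.W P l) hu hu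
    have e := integral_add (i1.add i2) i3
    simp only [Pi.add_apply] at e
    rw [← integral_const_mul, ← integral_add i1 i2, ← e]
    exact integral_nonneg fun ω =>
      dotProduct_fromBlocks (hP.fromBlocks_posSemidef hd hl hlN) _ _
  rw [qexp_sub hy hy, ← proj_top hl] at h2
  rw [← proj_top hl]
  linarith

theorem IsLMEI.energy_le_cost [IsFiniteMeasure μ] (hP : S.IsLMEI P) (htN : S.t < S.N)
    (hd : 2 ≤ S.d) (hw : IsNoise μ S.N w) (hQ : ∀ k, S.t ≤ k → k < S.N → (S.Q k).IsSymm)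
    (hG : S.G.IsSymm) {k : ℕ} (hk : S.t ≤ k) (hkN : k ≤ S.N)
    (ξ : Fin n → ℝ) {u : ℕ → Ω → Fin m → ℝ} (hu : u ∈ S.admissible μ w k) :
    S.energy μ w (fun i => P i k) k (fun _ => ξ) ≤ S.cost μ w k ξ u := by
  have hXN := memLp_state hw hk hu ξ hkN le_rfl
  have h1 : S.energy μ w (fun i => P i S.N) S.N (S.state w k ξ u S.N)
      ≤ qexp μ S.G (S.state w k ξ u S.N) (S.state w k ξ u S.N) := by
    rw [energy_terminal hw htN hP.terminal
      (stronglyMeasurable_state hw hk hu ξ (by omega) le_rfl) hXN, ← sub_nonneg, ← qexp_sub hXN hXN]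
    exact qexp_nonneg hP.terminal_zero _
  set f : ℕ → ℝ := fun l => S.energy μ w (fun i => P i l) l (S.state w k ξ u l) with hf
  -- With b the one-step defect the telescoping hypothesis is a tautology, and the content is that b
  -- is nonnegative.
  have h2 := sum_Ico_add_of_succ (f := f)
    (a := fun l => S.stage μ l (S.state w k ξ u l) (u l))
    (b := fun l => S.stage μ l (S.state w k ξ u l) (u l) + f (l + 1) - f l)
    hkN fun l hl hlN => by ring
  have h3 : 0 ≤ ∑ l ∈ Finset.Ico k S.N,
      (S.stage μ l (S.state w k ξ u l) (u l) + f (l + 1) - f l) := by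
    refine Finset.sum_nonneg fun l hl => ?_
    obtain ⟨hl, hlN⟩ := Finset.mem_Ico.1 hl
    rw [sub_nonneg, hf]
    simp only [state_succ hl]
    exact hP.le_stage_add_energy_next hd hw (hk.trans hl) hlN
      (hP.isSymm hd hQ hG (by omega) hlN)
      (stronglyMeasurable_state hw hk hu ξ hl hlN.le) (memLp_state hw hk hu ξ hl hlN.le)
      (hu l hl hlN).1 (hu l hl hlN).2
  have h4 : f k = S.energy μ w (fun i => P i k) k (fun _ => ξ) := by
    rw [hf]; simp only [state_of_le le_rfl]
  rw [cost_eq hw hk hu]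
  linarith

theorem IsLMEI.isFinite [IsFiniteMeasure μ] (hP : S.IsLMEI P) (htN : S.t < S.N)
    (hd : 2 ≤ S.d) (hw : IsNoise μ S.N w) (hQ : ∀ k, S.t ≤ k → k < S.N → (S.Q k).IsSymm)
    (hG : S.G.IsSymm) : S.IsFinite μ w := fun _ hk hkN ξ =>
  (EReal.bot_lt_coe _).trans_le (le_iInf₂ fun _ hu =>
    EReal.coe_le_coe_iff.2 (hP.energy_le_cost htN hd hw hQ hG hk hkN.le ξ hu))

/-! ### Feedback controls, necessity of the constraints, and optimality -/

theorem feedback_admissible (l : ℕ) {X : Ω → Fin n → ℝ} (hX : MemLp X 2 μ) :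
    StronglyMeasurable[S.info w l] (S.feedback μ w P l X) ∧ MemLp (S.feedback μ w P l X) 2 μ :=
  ⟨(StronglyMeasurable.mulVec stronglyMeasurable_condExp _).neg,
    (MemLp.mulVec (hX.condExp one_le_two) _).neg⟩

theorem closedControl_admissible [IsFiniteMeasure μ] (hw : IsNoise μ S.N w) {k : ℕ}
    (hk : S.t ≤ k) (ξ : Fin n → ℝ) : S.closedControl μ w P k ξ ∈ S.admissible μ w k :=
  (admissible_and_state hw hk (ξ := ξ) fun l _ _ _ hX => by
    rw [← closedState_eq_state] at hX
    exact feedback_admissible l hX).1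

/-- The state under the control that equals `v` at time `k` and the feedback afterwards. -/
noncomputable def perturbedState (S : Data n m) (μ : Measure Ω) (w : ℕ → Ω → ℝ)
    (P : ℕ → ℕ → Matrix (Fin n) (Fin n) ℝ) (k : ℕ) (ξ : Fin n → ℝ) (v : Fin m → ℝ) :
    ℕ → Ω → (Fin n → ℝ)
  | 0 => fun _ => ξ
  | l + 1 => if l < k then fun _ => ξ else
      S.next w l (S.perturbedState μ w P k ξ v l)
        (if l = k then fun _ => v else S.feedback μ w P l (S.perturbedState μ w P k ξ v l))

/-- The feedback reads the state, which is driven by the control. The recursion `perturbedState`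
resolves this circle, and the control is read off from it. -/
theorem exists_perturbed_control [IsFiniteMeasure μ] (hw : IsNoise μ S.N w) {k : ℕ}
    (hk : S.t ≤ k) (ξ : Fin n → ℝ) (v : Fin m → ℝ) (P : ℕ → ℕ → Matrix (Fin n) (Fin n) ℝ) :
    ∃ u ∈ S.admissible μ w k, u k = (fun _ => v) ∧
      ∀ l, k < l → u l = S.feedback μ w P l (S.state w k ξ u l) := by
  set u : ℕ → Ω → Fin m → ℝ := fun l =>
    if l = k then fun _ => v else S.feedback μ w P l (S.perturbedState μ w P k ξ v l) with hu
  have hs : ∀ l, S.perturbedState μ w P k ξ v l = S.state w k ξ u l := by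
    intro l
    induction l with
    | zero => rfl
    | succ l ih =>
      rw [perturbedState, state, ← ih]
      rfl
  have hul : ∀ l, k < l → u l = S.feedback μ w P l (S.state w k ξ u l) := fun l hl => by
    rw [← hs, hu]
    simp [hl.ne']
  have huk : u k = fun _ => v := by simp [hu]
  refine ⟨u, (admissible_and_state hw hk (ξ := ξ) fun l hl _ _ hX => ?_).1, huk, hul⟩
  rcases hl.eq_or_lt with rfl | hlt
  · rw [huk]
    exact ⟨stronglyMeasurable_const, memLp_const v⟩
  · rw [hul l hlt]
    exact feedback_admissible l hX

theorem exists_le_cost_of_bot_lt_value {k : ℕ} {ξ : Fin n → ℝ} (h : ⊥ < S.value μ w k ξ) :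
    ∃ c : ℝ, ∀ u ∈ S.admissible μ w k, c ≤ S.cost μ w k ξ u := by
  obtain ⟨c, _, hc⟩ := EReal.lt_iff_exists_real_btwn.1 h
  exact ⟨c, fun u hu => EReal.coe_le_coe_iff.1 (hc.le.trans (iInf₂_le u hu))⟩

/-- Backward induction on time: once the range condition holds after k, the later feedback has no
excess, so the cost is an explicit quadratic function of the first control v, bounded below by
finiteness. -/
theorem IsFinite.constraint [IsProbabilityMeasure μ] (hfin : S.IsFinite μ w)
    (hP : S.IsRiccati P) (htN : S.t < S.N) (hd : 2 ≤ S.d) (hw : IsNoise μ S.N w)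
    (hsymm : ∀ l, S.t ≤ l → l ≤ S.N → ∀ i ≤ S.top l, (P i l).IsSymm)
    (hR : ∀ k, S.t ≤ k → k < S.N → (S.R k).IsSymm) : S.Constraint P := by
  have step : ∀ k, S.t ≤ k → k < S.N →
      (∀ l, k + 1 ≤ l → l < S.N → S.W P l * pinv (S.W P l) * S.H P l = S.H P l) →
      S.W P k * pinv (S.W P k) * S.H P k = S.H P k ∧ (S.W P k).PosSemidef := by
    intro k hk hkN hlater
    have bdd : ∀ ξ : Fin n → ℝ, ∃ c : ℝ, ∀ v : Fin m → ℝ,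
        c ≤ v ⬝ᵥ (S.W P k *ᵥ v) + 2 * (v ⬝ᵥ (S.H P k *ᵥ ξ)) := by
      intro ξ
      obtain ⟨c, hc⟩ := exists_le_cost_of_bot_lt_value (hfin k hk hkN ξ)
      -- The energy of the constant ξ under `pre` is the part of the cost independent of v.
      refine ⟨c - S.energy μ w (fun i => S.pre P i k) k (fun _ => ξ), fun v => ?_⟩
      obtain ⟨u, hu, huk, hul⟩ := exists_perturbed_control (μ := μ) hw hk ξ v P
      have h1 := hc u hu
      have h2 := hP.tail_cost htN hd hw hsymm hR hk k.le_succ hkN hlater ξ hu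
      have h3 : ∑ l ∈ Finset.Ico (k + 1) S.N, S.excess μ w P l (S.state w k ξ u l) (u l) = 0 :=
        Finset.sum_eq_zero fun l hl => by
          rw [hul l (Finset.mem_Ico.1 hl).1, excess_feedback]
      have hyk : condExp (S.info w k) μ (fun _ => ξ) = fun _ => ξ := by
        rw [← proj_top hk, proj_const htN hw hkN.le]
      have h4 := stage_add_energy_next (μ := μ) hw hk hkN
        (stronglyMeasurable_state hw hk hu ξ le_rfl hkN.le) (memLp_state hw hk hu ξ le_rfl hkN.le)
        (hu k le_rfl hkN).1 (hu k le_rfl hkN).2 hd (hsymm (k + 1) (by omega) hkN)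
      rw [← state_succ le_rfl, huk, state_of_le le_rfl, hyk, qexp_const, qexp_const] at h4
      rw [cost_eq hw hk hu, Finset.sum_eq_sum_Ico_succ_bot hkN, huk, state_of_le le_rfl] at h1
      linarith
    have hWs : (S.W P k).IsSymm := W_isSymm hd (hR k hk hkN) (hsymm (k + 1) (by omega) hkN)
    refine ⟨?_, ?_⟩
    -- The matrix identity is tested on basis vectors ξ; for positivity ξ = 0 suffices.
    · refine ext_of_mulVec_single fun i => ?_
      rw [← mulVec_mulVec]
      obtain ⟨c, hc⟩ := bdd (Pi.single i 1)
      exact mul_pinv_mulVec_of_bddBelow hc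
    · obtain ⟨c, hc⟩ := bdd 0
      exact posSemidef_of_bddBelow hWs hc
  -- The claim covers all times from j on, because `step` needs the range condition at every later
  -- time.
  have all : ∀ j, j ≤ S.N → S.t ≤ j → ∀ l, j ≤ l → l < S.N →
      S.W P l * pinv (S.W P l) * S.H P l = S.H P l ∧ (S.W P l).PosSemidef := by
    intro j hj
    induction hj using Nat.decreasingInduction with
    | self => intro _ l hl hlN; omega
    | of_succ k hkN ih =>
      intro hk l hl hlN
      have ih := ih (by omega)
      rcases hl.eq_or_lt with rfl | hlt
      · exact step k hk hkN fun l hl hlN => (ih l hl hlN).1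
      · exact ih l hlt hlN
  exact fun k hk hkN => all k hkN.le hk k le_rfl hkN

theorem IsRiccati.isOptimal_closedControl [IsProbabilityMeasure μ]
    (hP : S.IsRiccati P) (htN : S.t < S.N) (hd : 2 ≤ S.d) (hw : IsNoise μ S.N w)
    (hsymm : ∀ l, S.t ≤ l → l ≤ S.N → ∀ i ≤ S.top l, (P i l).IsSymm)
    (hR : ∀ k, S.t ≤ k → k < S.N → (S.R k).IsSymm) (hC : S.Constraint P) {k : ℕ}
    (hk : S.t ≤ k) (hkN : k < S.N) (ξ : Fin n → ℝ) :
    S.IsOptimal μ w k ξ (S.closedControl μ w P k ξ) ∧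
      S.value μ w k ξ =
        ((∑ i ∈ Finset.range (S.top k + 1), ξ ⬝ᵥ (P i k *ᵥ ξ) : ℝ) : EReal) := by
  have hcost : ∀ u ∈ S.admissible μ w k, S.cost μ w k ξ u =
      ∑ i ∈ Finset.range (S.top k + 1), ξ ⬝ᵥ (P i k *ᵥ ξ)
        + ∑ l ∈ Finset.Ico k S.N, S.excess μ w P l (S.state w k ξ u l) (u l) := fun u hu => by
    rw [cost_eq hw hk hu, hP.tail_cost htN hd hw hsymm hR hk le_rfl hkN.le
      (fun l hl hlN => (hC l (hk.trans hl) hlN).1) ξ hu, state_of_le le_rfl,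
      energy_const htN hw _ hkN.le]
  have hadm := closedControl_admissible (μ := μ) (P := P) hw hk ξ
  have hclosed : S.cost μ w k ξ (S.closedControl μ w P k ξ) =
      ∑ i ∈ Finset.range (S.top k + 1), ξ ⬝ᵥ (P i k *ᵥ ξ) := by
    rw [hcost _ hadm, add_eq_left]
    refine Finset.sum_eq_zero fun l _ => ?_
    rw [← closedState_eq_state, closedControl, excess_feedback]
  have hval : S.value μ w k ξ =
      ((∑ i ∈ Finset.range (S.top k + 1), ξ ⬝ᵥ (P i k *ᵥ ξ) : ℝ) : EReal) := by
    refine le_antisymm ?_ (le_iInf₂ fun u hu => EReal.coe_le_coe_iff.2 ?_)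
    · rw [← hclosed]
      exact iInf₂_le _ hadm
    · rw [hcost u hu]
      refine le_add_of_nonneg_right (Finset.sum_nonneg fun l hl => ?_)
      obtain ⟨hl, hlN⟩ := Finset.mem_Ico.1 hl
      exact qexp_nonneg (hC l (hk.trans hl) hlN).2 _
  exact ⟨⟨hadm, by rw [hclosed, hval]⟩, hval⟩

theorem IsSolvable.isFinite (h : S.IsSolvable μ w) : S.IsFinite μ w := fun k hk hkN ξ => by
  obtain ⟨u, _, hu⟩ := h k hk hkN ξ
  rw [← hu]
  exact EReal.bot_lt_coe _

end Data

end DelayLQ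

/-! ### The main theorem -/

theorem mainTheorem1 {n m : ℕ} (S : DelayLQ.Data n m) (htN : S.t < S.N) (hd : 2 ≤ S.d)
    (hQ : ∀ k, S.t ≤ k → k < S.N → (S.Q k).IsSymm)
    (hR : ∀ k, S.t ≤ k → k < S.N → (S.R k).IsSymm)
    (hG : S.G.IsSymm)
    {Ω : Type*} [MeasurableSpace Ω] (μ : Measure Ω) [IsProbabilityMeasure μ]
    (w : ℕ → Ω → ℝ) (hw : DelayLQ.IsNoise μ S.N w) :
    (∃ P, S.IsRiccati P) ∧
    List.TFAE [
      S.IsFinite μ w,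
      S.IsSolvable μ w,
      ∀ P, S.IsRiccati P → S.Constraint P,
      ∃ P, S.IsRiccati P ∧ S.Constraint P,
      S.lmeiSolutions.Nonempty] ∧
    (S.IsFinite μ w → ∀ P, S.IsRiccati P →
      ∀ k, S.t ≤ k → k < S.N → ∀ ξ : Fin n → ℝ,
        S.IsOptimal μ w k ξ (S.closedControl μ w P k ξ) ∧
        S.value μ w k ξ =
          ((∑ i ∈ Finset.range (S.top k + 1), ξ ⬝ᵥ (P i k *ᵥ ξ) : ℝ) : EReal)) := by
  have hex : ∃ P, S.IsRiccati P := DelayLQ.Data.exists_isRiccati htN hd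
  have hsymm : ∀ P, S.IsRiccati P → ∀ l, S.t ≤ l → l ≤ S.N → ∀ i ≤ S.top l, (P i l).IsSymm :=
    fun P hP l hl hlN => hP.isSymm hd hQ hR hG hl hlN
  have hcon : S.IsFinite μ w → ∀ P, S.IsRiccati P → S.Constraint P := fun hfin P hP =>
    hfin.constraint hP htN hd hw (hsymm P hP) hR
  refine ⟨hex, ?_, fun hfin P hP k hk hkN ξ =>
    hP.isOptimal_closedControl htN hd hw (hsymm P hP) hR (hcon hfin P hP) hk hkN ξ⟩
  -- Uniqueness of the Riccati solution is not needed, and entries not occurring in the equations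
  -- are free: finiteness yields the constraints for every solution, while one constrained solution
  -- already gives solvability.
  tfae_have 1 → 3 := hcon
  tfae_have 3 → 4 := fun h => hex.imp fun P hP => ⟨hP, h P hP⟩
  tfae_have 4 → 2 := fun ⟨P, hP, hC⟩ k hk hkN ξ =>
    ⟨_, (hP.isOptimal_closedControl htN hd hw (hsymm P hP) hR hC hk hkN ξ).1⟩
  tfae_have 2 → 1 := fun h => h.isFinite
  tfae_have 4 → 5 := fun ⟨P, hP, hC⟩ => ⟨P, hP.isLMEI htN hd hC⟩
  tfae_have 5 → 1 := fun ⟨P, hP⟩ => DelayLQ.Data.IsLMEI.isFinite hP htN hd hw hQ hG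
  tfae_finish
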